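/- **Theorem ("$(n^{\delta})$-color standard Ramsey is PWPP-hard for all $\delta<1/2$").** Let $0<\delta<1/2$ and, for $n\ge 1$, put $k=k(n)=\lfloor n^{\delta}\rfloor$. In the *$(n^\delta)$-color standard Ramsey problem* an instance is a Boolean circuit that assigns to every two distinct vertices $u,v\in\{0,1\}^n$ a color of the edge $\{u,v\}$ (symmetric in $u,v$) from a set of $k$ colors, where $k\ge 2$; thus it describes a $k$-coloring of the edges of the complete graph on $2^n$ vertices. The task is to find a monochromatic clique with $\left\lfloor \frac{n}{k\log_2 k}\right\rfloor$ vertices. Let PWPP be the class of total NP search problems that are reducible to the problem of finding, given a Boolean circuit $C:\{0,1\}^n\to\{0,1\}^{n-1}$ ($n\ge 1$), a collision, i.e. $u\ne v$ with $C(u)=C(v)$. Then for every $\delta$ with $0<\delta<1/2$ the $(n^\delta)$-color standard Ramsey problem is PWPP-hard: every problem in PWPP reduces to it. Here "reduces" means by a deterministic polynomial-time many-one reduction between search problems: a polynomial-time map $f$ from instances to instances, together with a polynomial-time map $g$ such that $g(x,y)$ solves $x$ whenever $y$ solves $f(x)$. -/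

import Mathlib

namespace RamseyPWPP

/-! ### Machine model: structured programs over finitely many stacks of bits -/

/-- Programs of a multi-stack machine. A program names finitely many stacks (the registers that
occur in it), each holding a finite string of bits that is accessible only at its head. -/
inductive Program : Type
  /-- do nothing -/
  | skip : Program
  /-- push the bit `b` onto stack `r` -/
  | pushBit (r : ℕ) (b : Bool) : Program
  /-- pop the head of stack `r` (no effect on an empty stack) -/
  | popBit (r : ℕ) : Program
  /-- run the first program, then the second -/
  | seq (c₁ c₂ : Program) : Program
  /-- three-way branch: stack `r` is empty, has head `false`, has head `true` -/
  | branch (r : ℕ) (cEmpty cFalse cTrue : Program) : Program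
  /-- repeat the body as long as stack `r` is nonempty -/
  | loop (r : ℕ) (body : Program) : Program

/-- The contents of all stacks. -/
abbrev Store : Type := ℕ → List Bool

/-- `Run c s s' t`: program `c`, started in store `s`, halts in store `s'` after exactly `t`
steps. Every push, pop and test of the head of a stack takes one step. -/
inductive Run : Program → Store → Store → ℕ → Prop
  | skip (s : Store) : Run .skip s s 1
  | pushBit (r : ℕ) (b : Bool) (s : Store) :
      Run (.pushBit r b) s (Function.update s r (b :: s r)) 1
  | popBit (r : ℕ) (s : Store) :
      Run (.popBit r) s (Function.update s r (s r).tail) 1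
  | seq {c₁ c₂ : Program} {s s' s'' : Store} {t₁ t₂ : ℕ} :
      Run c₁ s s' t₁ → Run c₂ s' s'' t₂ → Run (.seq c₁ c₂) s s'' (t₁ + t₂)
  | branchEmpty {r : ℕ} {c₀ c₁ c₂ : Program} {s s' : Store} {t : ℕ} :
      s r = [] → Run c₀ s s' t → Run (.branch r c₀ c₁ c₂) s s' (t + 1)
  | branchFalse {r : ℕ} {c₀ c₁ c₂ : Program} {s s' : Store} {t : ℕ} :
      (s r).head? = some false → Run c₁ s s' t → Run (.branch r c₀ c₁ c₂) s s' (t + 1)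
  | branchTrue {r : ℕ} {c₀ c₁ c₂ : Program} {s s' : Store} {t : ℕ} :
      (s r).head? = some true → Run c₂ s s' t → Run (.branch r c₀ c₁ c₂) s s' (t + 1)
  | loopStop {r : ℕ} {c : Program} {s : Store} :
      s r = [] → Run (.loop r c) s s 1
  | loopStep {r : ℕ} {c : Program} {s s' s'' : Store} {t₁ t₂ : ℕ} :
      s r ≠ [] → Run c s s' t₁ → Run (.loop r c) s' s'' t₂ →
        Run (.loop r c) s s'' (t₁ + t₂ + 1)

/-- The initial store: the `a` arguments on stacks `0, …, a - 1`, all other stacks empty. -/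
def initialStore {a : ℕ} (v : Fin a → List Bool) : Store :=
  fun r => if h : r < a then v ⟨r, h⟩ else []

/-- `F`, a function of `a` bit strings, is computable in polynomial time: some program halts on
all arguments, within a number of steps polynomial in the total length of the arguments, with the
value of `F` on stack `0`. -/
def PolyTime {a : ℕ} (F : (Fin a → List Bool) → List Bool) : Prop :=
  ∃ (c : Program) (p : Polynomial ℕ), ∀ v : Fin a → List Bool,
    ∃ (s : Store) (t : ℕ), Run c (initialStore v) s t ∧
      t ≤ p.eval (∑ i, (v i).length) ∧ s 0 = F v

/-- Polynomial-time computability of a function of one bit string. -/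
def PolyTime₁ (f : List Bool → List Bool) : Prop :=
  PolyTime (a := 1) fun v => f (v 0)

/-- Polynomial-time computability of a function of two bit strings. -/
def PolyTime₂ (g : List Bool → List Bool → List Bool) : Prop :=
  PolyTime (a := 2) fun v => g (v 0) (v 1)

/-! ### Search problems, reductions and the class TFNP -/

/-- A search problem: a set of instances, and for each instance its solutions (certificates),
everything encoded by bit strings. -/
structure SearchProblem : Type where
  /-- the bit strings that encode instances -/
  IsInstance : List Bool → Prop
  /-- `IsSolution x y`: the string `y` encodes a solution of the instance `x` -/
  IsSolution : List Bool → List Bool → Prop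

/-- Deterministic polynomial-time many-one reduction between search problems: `f` maps instances
of `P` to instances of `Q`, and `g` turns every solution of `f x` into a solution of `x`. -/
def Reduces (P Q : SearchProblem) : Prop :=
  ∃ (f : List Bool → List Bool) (g : List Bool → List Bool → List Bool),
    PolyTime₁ f ∧ PolyTime₂ g ∧
      ∀ x, P.IsInstance x → Q.IsInstance (f x) ∧
        ∀ y, Q.IsSolution (f x) y → P.IsSolution x (g x y)

/-- Total NP search problems: instances are recognizable and solutions verifiable in polynomial
time, solutions have polynomially bounded length, and every instance has a solution. -/
structure InTFNP (P : SearchProblem) : Prop where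
  recognizable : ∃ d : List Bool → List Bool, PolyTime₁ d ∧
    ∀ x, d x = [true] ↔ P.IsInstance x
  verifiable : ∃ d : List Bool → List Bool → List Bool, PolyTime₂ d ∧
    ∀ x, P.IsInstance x → ∀ y, d x y = [true] ↔ P.IsSolution x y
  bounded : ∃ p : Polynomial ℕ,
    ∀ x, P.IsInstance x → ∀ y, P.IsSolution x y → y.length ≤ p.eval x.length
  total : ∀ x, P.IsInstance x → ∃ y, P.IsSolution x y

/-! ### Boolean circuits -/

/-- Boolean circuits over the complete basis {NAND}, as straight-line programs. The wires are
numbered: first the inputs `0, …, inputs - 1`, then one wire for each gate, in order. The gate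
`(i, j)` computes the NAND of the wires `i` and `j`. The list `outputs` names the output wires. -/
structure Circuit : Type where
  /-- number of input bits -/
  inputs : ℕ
  /-- the gates, in order of evaluation -/
  gates : List (ℕ × ℕ)
  /-- the output wires -/
  outputs : List ℕ

namespace Circuit

/-- Every gate reads earlier wires only, and every output is an existing wire. -/
def WellFormed (C : Circuit) : Prop :=
  (∀ (l : ℕ) (h : l < C.gates.length),
    C.gates[l].1 < C.inputs + l ∧ C.gates[l].2 < C.inputs + l) ∧
  ∀ o ∈ C.outputs, o < C.inputs + C.gates.length

/-- The values of all wires on input `x` (of length `C.inputs`). -/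
def wires (C : Circuit) (x : List Bool) : List Bool :=
  C.gates.foldl (fun w g => w ++ [!(w.getD g.1 false && w.getD g.2 false)]) x

/-- The output of the circuit on input `x` (of length `C.inputs`). -/
def eval (C : Circuit) (x : List Bool) : List Bool :=
  C.outputs.map fun o => (C.wires x).getD o false

/-- Unary, self-delimiting code of a natural number. -/
def encodeNat (i : ℕ) : List Bool := List.replicate i true ++ [false]

/-- The bit string that describes a circuit: number of inputs, number of gates, the gates, number
of outputs, the outputs. -/
def encode (C : Circuit) : List Bool :=
  encodeNat C.inputs ++ encodeNat C.gates.length ++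
    C.gates.flatMap (fun g => encodeNat g.1 ++ encodeNat g.2) ++
    encodeNat C.outputs.length ++ C.outputs.flatMap encodeNat

end Circuit

/-! ### The class PWPP -/

/-- The weak pigeonhole problem: given a circuit `C : {0,1}^n → {0,1}^(n-1)` with `n ≥ 1`, find a
collision, that is, `u ≠ v` in `{0,1}^n` with `C(u) = C(v)`; it is encoded by the concatenation
of `u` and `v`. -/
def weakPigeon : SearchProblem where
  IsInstance x := ∃ C : Circuit, x = C.encode ∧ C.WellFormed ∧
    C.inputs = C.outputs.length + 1
  IsSolution x y := ∃ C : Circuit, x = C.encode ∧ ∃ u v : List Bool, y = u ++ v ∧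
    u.length = C.inputs ∧ v.length = C.inputs ∧ u ≠ v ∧ C.eval u = C.eval v

/-- PWPP: the total NP search problems that reduce to the weak pigeonhole problem. -/
def PWPP : Set SearchProblem := {P | InTFNP P ∧ Reduces P weakPigeon}

/-- A search problem is PWPP-hard if every problem in PWPP reduces to it. -/
def PWPPHard (Q : SearchProblem) : Prop := ∀ P ∈ PWPP, Reduces P Q

/-! ### The multi-color Ramsey problem -/

/-- The color of the pair `(u, v)`: the number whose binary digits, least significant first, are
the output bits of the circuit on the concatenation of `u` and `v`. -/
def edgeColor (C : Circuit) (u v : List Bool) : ℕ :=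
  Nat.ofDigits 2 ((C.eval (u ++ v)).map Bool.toNat)

/-- The circuit `C`, with `2n` inputs, describes a coloring of the edges of the complete graph on
the vertex set `{0,1}^n` with the colors `0, …, k - 1`. -/
def ColorsEdges (C : Circuit) (n k : ℕ) : Prop :=
  C.WellFormed ∧ C.inputs = 2 * n ∧
    ∀ u v : List Bool, u.length = n → v.length = n → u ≠ v →
      edgeColor C u v = edgeColor C v u ∧ edgeColor C u v < k

/-- `a` lists the vertices of a monochromatic clique with `t` vertices in the complete graph on
`{0,1}^n` whose edges are colored by `C`. -/
def IsMonochromaticClique (C : Circuit) (n t : ℕ) (a : List (List Bool)) : Prop :=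
  a.length = t ∧ a.Nodup ∧ (∀ u ∈ a, u.length = n) ∧
    ∃ color : ℕ, ∀ u ∈ a, ∀ v ∈ a, u ≠ v → edgeColor C u v = color

/-- The `(k, t)`-color Ramsey problem, where `k` and `t` may depend on `n`: given a circuit that
colors the edges of the complete graph on `{0,1}^n` with `k n ≥ 2` colors, find a monochromatic
clique of `t n` vertices; it is encoded by the concatenation of its vertices. -/
def colorRamsey (k t : ℕ → ℕ) : SearchProblem where
  IsInstance x := ∃ (C : Circuit) (n : ℕ), x = C.encode ∧ 2 ≤ k n ∧ ColorsEdges C n (k n)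
  IsSolution x y := ∃ (C : Circuit) (n : ℕ), x = C.encode ∧ C.inputs = 2 * n ∧
    ∃ a : List (List Bool), y = a.flatten ∧ IsMonochromaticClique C n (t n) a

/-- The `k`-color standard Ramsey problem: the monochromatic clique sought has
`n / (k log₂ k)` vertices (rounded down), where `2 ^ n` is the number of vertices. -/
noncomputable def standardRamsey (k : ℕ → ℕ) : SearchProblem :=
  colorRamsey k fun n => ⌊(n : ℝ) / ((k n : ℝ) * Real.logb 2 (k n : ℝ))⌋₊

end RamseyPWPP

/-! Let `C` map `m` bits to `s = m - 1` bits. Used as a compression function, `C` gives an iterated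
hash function `h` from strings of any length `n` to `s` bits: start with the zero state and absorb
one bit of the input per application of `C`. If `u ≠ v` have length `n` and `h u = h v`, comparing
the two computations backwards from the last step leads to a step at which the inputs of `C` differ
and the outputs agree, which is a collision of `C` (`exists_collision`).

Color the edge between `u` and `v` by the last position at which `h u` and `h v` differ, and by `0`
if there is none. This is symmetric and uses at most `max s 1 ≤ m` colors. A monochromatic triangle
with three distinct hash values is impossible: at the position given by the color, three bits would
be pairwise different (`exists_hashState_eq`). Hence any three vertices of a monochromatic clique
contain two with equal hash values, and rerunning the hash on the three pairs exhibits a collision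
(`codesCollision_findCollision`).

It remains to choose `n` polynomial in `m` such that at least `m` colors are allowed and the clique
has at least three vertices. With `n = (m + 6561) ^ e` and `e ≥ 1 / δ` the number `k` of colors is
at least `m + 6561` (`exists_exponent`). As `δ < 1 / 2`, one has `k ≤ n ^ (1/2)` and `log₂ k ≤ 3 * n
^ (1/4)`, so `n / (k log₂ k) ≥ n ^ (1/4) / 3 ≥ 3` (`three_le_cliqueSize`).

The rest is complexity theory. The coloring must be written out as a NAND circuit (`colorCircuit`,
verified in `edgeColor_colorCircuit`), and both maps of the reduction must run in polynomial time on
the stack machine. For this, the predicate `PT` is closed under composition, pairing, branching and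
iteration with polynomially bounded intermediate values, so that most functions are handled by
`fun_prop`. Since membership in PWPP provides arbitrary programs, `PT` is also compared with
`PolyTime` in both directions, which gives transitivity of reductions (`Reduces.trans`). -/

namespace RamseyPWPP

/-! ### Running programs within a time bound -/

/-- Program `c` leads from `s` to `s'` within `T` steps. -/
def Runs (c : Program) (s s' : Store) (T : ℕ) : Prop := ∃ t ≤ T, Run c s s' t

theorem Runs.mono {c : Program} {s s' : Store} {T T' : ℕ} (h : Runs c s s' T) (hT : T ≤ T') :
    Runs c s s' T' := by
  obtain ⟨t, ht, hr⟩ := h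
  exact ⟨t, ht.trans hT, hr⟩

theorem Runs.congr {c : Program} {s s' s'' : Store} {T : ℕ} (h : Runs c s s' T) (hs : s' = s'') :
    Runs c s s'' T := hs ▸ h

theorem Runs.seq {c₁ c₂ : Program} {s s' s'' : Store} {T₁ T₂ : ℕ}
    (h₁ : Runs c₁ s s' T₁) (h₂ : Runs c₂ s' s'' T₂) : Runs (.seq c₁ c₂) s s'' (T₁ + T₂) := by
  obtain ⟨t₁, ht₁, hr₁⟩ := h₁
  obtain ⟨t₂, ht₂, hr₂⟩ := h₂
  exact ⟨t₁ + t₂, by omega, .seq hr₁ hr₂⟩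

theorem runs_skip (s : Store) : Runs .skip s s 1 := ⟨1, le_rfl, .skip s⟩

theorem runs_pushBit (r : ℕ) (b : Bool) (s : Store) :
    Runs (.pushBit r b) s (Function.update s r (b :: s r)) 1 := ⟨1, le_rfl, .pushBit r b s⟩

theorem runs_popBit (r : ℕ) (s : Store) :
    Runs (.popBit r) s (Function.update s r (s r).tail) 1 := ⟨1, le_rfl, .popBit r s⟩

theorem Runs.branchEmpty {r : ℕ} {c₀ c₁ c₂ : Program} {s s' : Store} {T : ℕ} (hr : s r = [])
    (h : Runs c₀ s s' T) : Runs (.branch r c₀ c₁ c₂) s s' (T + 1) := by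
  obtain ⟨t, ht, h⟩ := h
  exact ⟨t + 1, by omega, .branchEmpty hr h⟩

theorem Runs.branchFalse {r : ℕ} {c₀ c₁ c₂ : Program} {s s' : Store} {T : ℕ} {l : List Bool}
    (hr : s r = false :: l) (h : Runs c₁ s s' T) : Runs (.branch r c₀ c₁ c₂) s s' (T + 1) := by
  obtain ⟨t, ht, h⟩ := h
  exact ⟨t + 1, by omega, .branchFalse (by simp [hr]) h⟩

theorem Runs.branchTrue {r : ℕ} {c₀ c₁ c₂ : Program} {s s' : Store} {T : ℕ} {l : List Bool}
    (hr : s r = true :: l) (h : Runs c₂ s s' T) : Runs (.branch r c₀ c₁ c₂) s s' (T + 1) := by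
  obtain ⟨t, ht, h⟩ := h
  exact ⟨t + 1, by omega, .branchTrue (by simp [hr]) h⟩

theorem runs_loop_nil {r : ℕ} {c : Program} {s : Store} (h : s r = []) : Runs (.loop r c) s s 1 :=
  ⟨1, le_rfl, .loopStop h⟩

theorem Runs.loopStep {r : ℕ} {c : Program} {s s' s'' : Store} {T₁ T₂ : ℕ} (h : s r ≠ [])
    (h₁ : Runs c s s' T₁) (h₂ : Runs (.loop r c) s' s'' T₂) :
    Runs (.loop r c) s s'' (T₁ + T₂ + 1) := by
  obtain ⟨t₁, ht₁, hr₁⟩ := h₁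
  obtain ⟨t₂, ht₂, hr₂⟩ := h₂
  exact ⟨t₁ + t₂ + 1, by omega, .loopStep h hr₁ hr₂⟩

/-- A loop whose successive stores are `S 0, …, S n`. -/
theorem runs_loop_of_forall {r : ℕ} {c : Program} (S : ℕ → Store) (n T : ℕ)
    (hS : ∀ j < n, S j r ≠ [] ∧ Runs c (S j) (S (j + 1)) T) (hn : S n r = []) :
    Runs (.loop r c) (S 0) (S n) (n * (T + 1) + 1) := by
  induction n generalizing S with
  | zero => simpa using runs_loop_nil hn
  | succ n ih =>
    have h := ih (fun j => S (j + 1)) (fun j hj => hS (j + 1) (by omega)) hn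
    exact ((hS 0 (by omega)).2.loopStep (hS 0 (by omega)).1 h).mono (by ring_nf; omega)

/-- Empty the stack `r`. -/
def clear (r : ℕ) : Program := .loop r (.popBit r)

theorem runs_clear (r : ℕ) (s : Store) :
    Runs (clear r) s (Function.update s r []) (2 * (s r).length + 1) := by
  generalize hl : s r = l
  induction l generalizing s with
  | nil => exact (runs_loop_nil hl).congr (by simp [← hl])
  | cons b l ih =>
    have h := ih (Function.update s r (s r).tail) (by simp [hl])
    refine ((Runs.loopStep (by simp [hl]) (runs_popBit r s) h).mono ?_).congr ?_
    · simp; omega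
    · simp

/-- Pop everything from the stack `a` and push it onto the stack `b`. -/
def moveRev (a b : ℕ) : Program :=
  .loop a (.seq (.branch a .skip (.pushBit b false) (.pushBit b true)) (.popBit a))

theorem runs_moveRev {a b : ℕ} (hab : a ≠ b) (s : Store) :
    Runs (moveRev a b) s
      (Function.update (Function.update s a []) b ((s a).reverse ++ s b))
      (4 * (s a).length + 1) := by
  generalize hl : s a = l
  induction l generalizing s with
  | nil => exact (runs_loop_nil hl).congr (by
      rw [show Function.update s a [] = s by rw [← hl, Function.update_eq_self]]; simp)
  | cons x l ih =>
    have h := ih (Function.update (Function.update s b (x :: s b)) a l) (by simp)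
    have hb : Runs (.branch a .skip (.pushBit b false) (.pushBit b true)) s
        (Function.update s b (x :: s b)) 2 := by
      cases x
      · exact Runs.branchFalse hl (runs_pushBit _ _ _)
      · exact Runs.branchTrue hl (runs_pushBit _ _ _)
    have hp := runs_popBit a (Function.update s b (x :: s b))
    rw [Function.update_of_ne hab, hl, List.tail_cons] at hp
    refine ((Runs.loopStep (by simp [hl]) (hb.seq hp) h).mono ?_).congr ?_
    · simp; omega
    · funext r
      simp only [Function.update_apply]
      split_ifs <;> simp_all

/-- Move the content of the stack `a` on top of that of the stack `b`, using the scratch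
stack `k`. -/
def move (a b k : ℕ) : Program := .seq (moveRev a k) (moveRev k b)

theorem runs_move {a b k : ℕ} (hab : a ≠ b) (hak : a ≠ k) (hbk : b ≠ k) (s : Store)
    (hk : s k = []) :
    Runs (move a b k) s (Function.update (Function.update s a []) b (s a ++ s b))
      (8 * (s a).length + 2) := by
  refine (((runs_moveRev hak s).seq (runs_moveRev hbk.symm _)).mono ?_).congr ?_
  · simp [hk]; omega
  · funext r
    simp only [Function.update_apply]
    split_ifs <;> simp_all

/-- Pop everything from the stack `k` and push it onto both stacks `a` and `b`. -/
def moveRevBoth (k a b : ℕ) : Program :=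
  .loop k (.seq (.branch k .skip (.seq (.pushBit a false) (.pushBit b false))
    (.seq (.pushBit a true) (.pushBit b true))) (.popBit k))

theorem runs_moveRevBoth {k a b : ℕ} (hka : k ≠ a) (hkb : k ≠ b) (hab : a ≠ b) (s : Store) :
    Runs (moveRevBoth k a b) s
      (Function.update (Function.update (Function.update s k []) a ((s k).reverse ++ s a)) b
        ((s k).reverse ++ s b)) (5 * (s k).length + 1) := by
  generalize hl : s k = l
  induction l generalizing s with
  | nil => exact (runs_loop_nil hl).congr (by
      rw [show Function.update s k [] = s by rw [← hl, Function.update_eq_self]]; simp)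
  | cons x l ih =>
    have h := ih (Function.update (Function.update (Function.update s a (x :: s a)) b (x :: s b))
      k l) (by simp)
    have hb : Runs (.branch k .skip (.seq (.pushBit a false) (.pushBit b false))
        (.seq (.pushBit a true) (.pushBit b true))) s
        (Function.update (Function.update s a (x :: s a)) b (x :: s b)) 3 := by
      have h₂ := (runs_pushBit a x s).seq (runs_pushBit b x (Function.update s a (x :: s a)))
      rw [Function.update_of_ne hab.symm] at h₂
      cases x
      · exact Runs.branchFalse hl h₂
      · exact Runs.branchTrue hl h₂
    have hp := runs_popBit k (Function.update (Function.update s a (x :: s a)) b (x :: s b))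
    rw [Function.update_of_ne hkb, Function.update_of_ne hka, hl, List.tail_cons] at hp
    refine ((Runs.loopStep (by simp [hl]) (hb.seq hp) h).mono ?_).congr ?_
    · simp; omega
    · funext r
      simp only [Function.update_apply]
      split_ifs <;> simp_all

/-- Copy the stack `i` to the stack `o`, using the scratch stack `k`. -/
def copy (i o k : ℕ) : Program := .seq (moveRev i k) (moveRevBoth k i o)

theorem runs_copy {i o k : ℕ} (hio : i ≠ o) (hik : i ≠ k) (hok : o ≠ k) (s : Store)
    (hk : s k = []) (ho : s o = []) :
    Runs (copy i o k) s (Function.update s o (s i)) (9 * (s i).length + 2) := by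
  refine (((runs_moveRev hik s).seq
    (runs_moveRevBoth hik.symm hok.symm hio _)).mono ?_).congr ?_
  · simp [hk]; omega
  · funext r
    simp only [Function.update_apply]
    split_ifs <;> simp_all

/-- Push the string `l` onto the stack `r`. -/
def pushAll (r : ℕ) : List Bool → Program
  | [] => .skip
  | b :: l => .seq (pushAll r l) (.pushBit r b)

theorem runs_pushAll (r : ℕ) (l : List Bool) (s : Store) :
    Runs (pushAll r l) s (Function.update s r (l ++ s r)) (l.length + 1) := by
  induction l with
  | nil => exact (runs_skip s).congr (by simp)
  | cons b l ih =>
    refine ((ih.seq (runs_pushBit r b _)).mono ?_).congr ?_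
    · simp
    · simp

/-! ### Self-delimiting codes of strings -/

/-- A self-delimiting code of the string `l`. -/
def esc (l : List Bool) : List Bool := l.flatMap (fun b => [true, b]) ++ [false]

theorem length_esc (l : List Bool) : (esc l).length = 2 * l.length + 1 := by
  simp [esc, Nat.mul_comm]

/-- Prepend the code of the content of `a` to the content of `o` and empty `a`. -/
def escTo (a o k : ℕ) : Program :=
  .seq (.seq (.pushBit o false) (moveRev a k))
    (.loop k (.seq (.branch k .skip (.pushBit o false) (.pushBit o true))
      (.seq (.pushBit o true) (.popBit k))))

/-- The string lies reversed on `k`, and pushing reverses it once more. Each bit is pushed before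
its marker `true`, so that a reader meets the marker first. -/
theorem runs_escTo_loop {k o : ℕ} (hko : k ≠ o) (s : Store) :
    Runs (.loop k (.seq (.branch k .skip (.pushBit o false) (.pushBit o true))
      (.seq (.pushBit o true) (.popBit k)))) s
      (Function.update (Function.update s k []) o
        ((s k).reverse.flatMap (fun b => [true, b]) ++ s o)) (5 * (s k).length + 1) := by
  generalize hl : s k = l
  induction l generalizing s with
  | nil => exact (runs_loop_nil hl).congr (by
      rw [show Function.update s k [] = s by rw [← hl, Function.update_eq_self]]; simp)
  | cons x l ih =>
    have h := ih (Function.update (Function.update s o (true :: x :: s o)) k l) (by simp)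
    have hb : Runs (.branch k .skip (.pushBit o false) (.pushBit o true)) s
        (Function.update s o (x :: s o)) 2 := by
      cases x
      · exact Runs.branchFalse hl (runs_pushBit _ _ _)
      · exact Runs.branchTrue hl (runs_pushBit _ _ _)
    have hp := (runs_pushBit o true (Function.update s o (x :: s o))).seq (runs_popBit k _)
    simp only [Function.update_self, Function.update_idem, Function.update_of_ne hko, hl,
      List.tail_cons] at hp
    refine ((Runs.loopStep (by simp [hl]) (hb.seq hp) h).mono ?_).congr ?_
    · simp; omega
    · funext r
      simp only [Function.update_apply]
      split_ifs <;> simp_all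

theorem runs_escTo {a o k : ℕ} (hao : a ≠ o) (hak : a ≠ k) (hok : o ≠ k) (s : Store)
    (hk : s k = []) :
    Runs (escTo a o k) s (Function.update (Function.update s a []) o (esc (s a) ++ s o))
      (9 * (s a).length + 3) := by
  refine ((((runs_pushBit o false s).seq (runs_moveRev hak _)).seq
    (runs_escTo_loop hok.symm _)).mono ?_).congr ?_
  · simp [hk, hao, hok.symm]; omega
  · funext r
    simp only [Function.update_apply, esc]
    split_ifs <;> simp_all

/-- Split a content `esc l ++ l'` of the stack `a`: leave `l'` on `a` and the reversal of `l`
on `b`. -/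
def unesc (a b k : ℕ) : Program :=
  .seq (.pushBit k true)
    (.loop k (.branch a .skip (.seq (.popBit a) (.popBit k))
      (.seq (.popBit a)
        (.seq (.branch a .skip (.pushBit b false) (.pushBit b true)) (.popBit a)))))

/-- The single bit on `k` is a flag that keeps the loop alive; it is popped when the terminator
`false` of the code is met. Bits leave `a` front to back, which is why `b` receives the reversal. -/
theorem runs_unesc_loop {a b k : ℕ} (hab : a ≠ b) (hak : a ≠ k) (hbk : b ≠ k) (l l' : List Bool)
    (s : Store) (hk : s k = [true]) (ha : s a = esc l ++ l') :
    Runs (.loop k (.branch a .skip (.seq (.popBit a) (.popBit k))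
      (.seq (.popBit a)
        (.seq (.branch a .skip (.pushBit b false) (.pushBit b true)) (.popBit a))))) s
      (Function.update (Function.update (Function.update s k []) a l') b (l.reverse ++ s b))
      (6 * l.length + 5) := by
  induction l generalizing s with
  | nil =>
    have ha' : s a = false :: l' := by simpa [esc] using ha
    have h₁ := runs_popBit a s
    rw [ha', List.tail_cons] at h₁
    have h := h₁.seq (runs_popBit k _)
    refine ((Runs.loopStep (by simp [hk]) (Runs.branchFalse ha' h)
      (runs_loop_nil ?_)).mono ?_).congr ?_
    · simp [hak.symm, hk]
    · simp
    · funext r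
      simp only [Function.update_apply]
      split_ifs <;> simp_all
  | cons x l ih =>
    have ha' : s a = true :: x :: (esc l ++ l') := by simpa [esc] using ha
    have h := ih (Function.update (Function.update s b (x :: s b)) a (esc l ++ l'))
      (by simp [hak.symm, hbk.symm, hk]) (by simp)
    have h₁ := runs_popBit a s
    rw [ha', List.tail_cons] at h₁
    have h₂ : Runs (.branch a .skip (.pushBit b false) (.pushBit b true))
        (Function.update s a (x :: (esc l ++ l')))
        (Function.update (Function.update s a (x :: (esc l ++ l'))) b (x :: s b)) 2 := by
      have h₃ := runs_pushBit b x (Function.update s a (x :: (esc l ++ l')))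
      rw [Function.update_of_ne hab.symm] at h₃
      cases x
      · exact Runs.branchFalse (by simp; rfl) h₃
      · exact Runs.branchTrue (by simp; rfl) h₃
    have h₃ := h₁.seq (h₂.seq (runs_popBit a _))
    have hE : Function.update (Function.update (Function.update s a (x :: (esc l ++ l'))) b
        (x :: s b)) a ((Function.update (Function.update s a (x :: (esc l ++ l'))) b
        (x :: s b)) a).tail
        = Function.update (Function.update s b (x :: s b)) a (esc l ++ l') := by
      funext r
      simp only [Function.update_apply]
      split_ifs <;> simp_all
    rw [hE] at h₃
    refine ((Runs.loopStep (by simp [hk]) (Runs.branchTrue ha' h₃) h).mono ?_).congr ?_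
    · simp; omega
    · funext r
      simp only [Function.update_apply]
      split_ifs <;> simp_all

theorem runs_unesc {a b k : ℕ} (hab : a ≠ b) (hak : a ≠ k) (hbk : b ≠ k) (l l' : List Bool)
    (s : Store) (hk : s k = []) (hb : s b = []) (ha : s a = esc l ++ l') :
    Runs (unesc a b k) s (Function.update (Function.update s a l') b l.reverse)
      (6 * l.length + 6) := by
  have h := runs_pushBit k true s
  rw [hk] at h
  refine ((h.seq (runs_unesc_loop hab hak hbk l l' _ (by simp)
    (by simp [hak, ha]))).mono (by omega)).congr ?_
  funext r
  simp only [Function.update_apply]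
  split_ifs <;> simp_all


/-! ### Monotone time bounds and the growth of stacks. -/

theorem eval_mono (p : Polynomial ℕ) {a b : ℕ} (h : a ≤ b) : p.eval a ≤ p.eval b := by
  induction p using Polynomial.induction_on' with
  | add p q hp hq => simpa using Nat.add_le_add hp hq
  | monomial n c => simpa using Nat.mul_le_mul_left c (Nat.pow_le_pow_left h n)

/-- A step pushes at most one bit. Hence a time bound also controls the size of the output. -/
theorem Run.length_le {c : Program} {s s' : Store} {t : ℕ} (h : Run c s s' t) (r : ℕ) :
    (s' r).length ≤ (s r).length + t := by
  induction h with
  | skip s => omega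
  | pushBit r' b s => by_cases h : r = r' <;> simp [h]
  | popBit r' s => by_cases h : r = r' <;> simp [h]; omega
  | seq _ _ ih₁ ih₂ => omega
  | branchEmpty _ _ ih => omega
  | branchFalse _ _ ih => omega
  | branchTrue _ _ ih => omega
  | loopStop _ => omega
  | loopStep _ _ _ ih₁ ih₂ => omega

/-! ### Types whose elements are coded by strings, and their polynomial-time functions -/

/-- A type whose elements are coded by bit strings. -/
class Code (α : Type) where
  /-- the code of an element -/
  enc : α → List Bool

/-- A type whose finite lists are coded element by element. -/
class Item (α : Type) : Prop


open Code (enc)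

instance : Code (List Bool) := ⟨id⟩

instance : Code Bool := ⟨fun b => [b]⟩

/-- The unary code suits numbers that count inputs, gates and wires: it makes a polynomial bound on
the value a bound on the length of the code. -/
instance : Code ℕ := ⟨fun n => List.replicate n true⟩

instance {α β : Type} [Code α] [Code β] : Code (α × β) := ⟨fun x => esc (enc x.1) ++ enc x.2⟩

/-- `Bool` is deliberately not an `Item`, so that a string of bits keeps itself as its only code. -/
instance {α : Type} [Code α] [Item α] : Code (List α) := ⟨fun l => l.flatMap fun a => esc (enc a)⟩

instance : Item ℕ := ⟨⟩

instance {α β : Type} : Item (α × β) := ⟨⟩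

@[simp] theorem enc_string (l : List Bool) : enc l = l := rfl

theorem enc_nat (n : ℕ) : enc n = List.replicate n true := rfl

theorem enc_prod {α β : Type} [Code α] [Code β] (x : α × β) :
    enc x = esc (enc x.1) ++ enc x.2 := rfl

theorem enc_cons {α : Type} [Code α] [Item α] (a : α) (l : List α) :
    enc (a :: l) = esc (enc a) ++ enc l := rfl

theorem enc_append {α : Type} [Code α] [Item α] (l l' : List α) :
    enc (l ++ l') = enc l ++ enc l' := List.flatMap_append

@[simp] theorem length_enc_nat (n : ℕ) : (enc n).length = n := by simp [enc_nat]

@[simp] theorem length_enc_prod {α β : Type} [Code α] [Code β] (x : α × β) :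
    (enc x).length = 2 * (enc x.1).length + 1 + (enc x.2).length := by
  simp [enc_prod, length_esc]

@[simp] theorem length_enc_nil {α : Type} [Code α] [Item α] :
    (enc ([] : List α)).length = 0 := rfl

@[simp] theorem length_enc_cons {α : Type} [Code α] [Item α] (a : α) (l : List α) :
    (enc (a :: l)).length = 2 * (enc a).length + 1 + (enc l).length := by
  simp [enc_cons, length_esc]

@[simp] theorem length_enc_append {α : Type} [Code α] [Item α] (l l' : List α) :
    (enc (l ++ l')).length = (enc l).length + (enc l').length := by
  simp [enc_append]

/-- Polynomial-time functions between coded types: for all registers `i` and `o` and all `N`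
above them there is a program that writes the code of `f x` to the empty stack `o` when it finds
the code of `x` on the stack `i`, using the empty stacks from `N` on as scratch space. -/
@[fun_prop]
structure PT {α β : Type} [Code α] [Code β] (f : α → β) : Prop where
  /-- the time bound and the programs -/
  out : ∃ p : Polynomial ℕ, ∀ i o N : ℕ, i < N → o < N → i ≠ o →
    ∃ c : Program, ∀ (s : Store) (x : α), (∀ r, N ≤ r → s r = []) → s i = enc x → s o = [] →
      Runs c s (Function.update s o (enc (f x))) (p.eval (enc x).length)

/-! ### Closure properties of `PT`. -/

theorem update_scratch {N o : ℕ} {s : Store} (h : s N = []) (a b e : List Bool) :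
    Function.update (Function.update (Function.update (Function.update s N a) o b) N []) o e =
      Function.update s o e := by
  funext r
  simp only [Function.update_apply]
  split_ifs <;> simp_all

theorem update_scratch' {N o : ℕ} (hN : o ≠ N) {s : Store} (h : s N = []) (a b : List Bool) :
    Function.update (Function.update (Function.update s N a) o b) N [] =
      Function.update s o b := by
  funext r
  simp only [Function.update_apply]
  split_ifs <;> simp_all

section
variable {α β γ δ : Type} [Code α] [Code β] [Code γ] [Code δ]

/-- The output starts empty and grows by at most one bit per step, so the time bound serves as the
length bound too. Every construction that feeds `f x` to a further program needs this. -/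
theorem PT.exists_bound {f : α → β} (hf : PT f) : ∃ p : Polynomial ℕ,
    (∀ x, (enc (f x)).length ≤ p.eval (enc x).length) ∧
    ∀ i o N : ℕ, i < N → o < N → i ≠ o → ∃ c : Program, ∀ (s : Store) (x : α),
      (∀ r, N ≤ r → s r = []) → s i = enc x → s o = [] →
        Runs c s (Function.update s o (enc (f x))) (p.eval (enc x).length) := by
  obtain ⟨p, hp⟩ := hf.out
  refine ⟨p, fun x => ?_, hp⟩
  obtain ⟨c, hc⟩ := hp 0 1 2 (by omega) (by omega) (by omega)
  obtain ⟨t, ht, h⟩ := hc (Function.update (fun _ => []) 0 (enc x)) x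
    (fun r hr => by simp [Function.update_apply]; omega) (by simp) (by simp)
  have := h.length_le 1
  simp at this
  omega

theorem PT.congr {f g : α → β} (hf : PT f) (h : ∀ x, f x = g x) : PT g := (funext h : f = g) ▸ hf

/-- Polynomial-time computability depends on the codes only. -/
theorem PT.recode {f : α → β} {g : γ → δ} (hf : PT f) (e : γ → α)
    (he : ∀ x, enc x = enc (e x)) (h : ∀ x, enc (g x) = enc (f (e x))) : PT g := by
  obtain ⟨p, hp⟩ := hf.out
  refine ⟨p, fun i o N hi ho hio => ?_⟩
  obtain ⟨c, hc⟩ := hp i o N hi ho hio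
  refine ⟨c, fun s x hs hsi hso => ?_⟩
  rw [h x, he x]
  exact hc s (e x) hs (hsi.trans (he x)) hso

@[fun_prop]
theorem PT.id : PT (fun x : α => x) := by
  refine ⟨9 * Polynomial.X + 2, fun i o N hi ho hio => ⟨copy i o N, fun s x hs hsi hso => ?_⟩⟩
  have h := runs_copy hio hi.ne ho.ne s (hs N le_rfl) hso
  rw [hsi] at h
  exact h.mono (by simp)

@[fun_prop]
theorem PT.const (b : β) : PT (fun _ : α => b) := by
  refine ⟨Polynomial.C ((enc b).length + 1), fun i o N hi ho hio =>
    ⟨pushAll o (enc b), fun s x hs hsi hso => ?_⟩⟩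
  have h := runs_pushAll o (enc b) s
  rw [hso, List.append_nil] at h
  exact h.mono (by simp)

@[fun_prop]
theorem PT.comp {g : β → γ} {f : α → β} (hg : PT g) (hf : PT f) : PT (fun x => g (f x)) := by
  obtain ⟨p, hpl, hp⟩ := hf.exists_bound
  obtain ⟨q, hq⟩ := hg.out
  -- `p` steps compute `f x`, `q.comp p` steps apply `g` to a string of length at most `p`, and `2 *
  -- p + 1` steps erase the intermediate value.
  refine ⟨3 * p + q.comp p + 1, fun i o N hi ho hio => ?_⟩
  obtain ⟨c, hc⟩ := hp i N (N + 1) (by omega) (by omega) (by omega)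
  obtain ⟨d, hd⟩ := hq N o (N + 1) (by omega) (by omega) (by omega)
  refine ⟨.seq c (.seq d (clear N)), fun s x hs hsi hso => ?_⟩
  have h₁ := hc s x (fun r hr => hs r (by omega)) hsi (hs N le_rfl)
  have h₂ := hd (Function.update s N (enc (f x))) (f x)
    (fun r hr => by rw [Function.update_of_ne (by omega)]; exact hs r (by omega)) (by simp)
    (by rw [Function.update_of_ne (by omega), hso])
  refine ((h₁.seq (h₂.seq (runs_clear N _))).mono ?_).congr ?_
  · have h₃ := hpl x
    have h₄ := eval_mono q h₃
    simp [ho.ne']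
    omega
  · exact update_scratch' ho.ne (hs N le_rfl) _ _

@[fun_prop]
theorem PT.pair {f : α → β} {g : α → γ} (hf : PT f) (hg : PT g) : PT (fun x => (f x, g x)) := by
  obtain ⟨p, hpl, hp⟩ := hf.exists_bound
  obtain ⟨q, hq⟩ := hg.out
  -- The second component is written to `o` first; the code of the first one, computed on the stack
  -- `N`, is then put in front of it in `9 * p + 3` steps.
  refine ⟨10 * p + q + 3, fun i o N hi ho hio => ?_⟩
  obtain ⟨c, hc⟩ := hp i N (N + 1) (by omega) (by omega) (by omega)
  obtain ⟨d, hd⟩ := hq i o (N + 1) (by omega) (by omega) (by omega)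
  refine ⟨.seq c (.seq d (escTo N o (N + 1))), fun s x hs hsi hso => ?_⟩
  have h₁ := hc s x (fun r hr => hs r (by omega)) hsi (hs N le_rfl)
  have h₂ := hd (Function.update s N (enc (f x))) x
    (fun r hr => by rw [Function.update_of_ne (by omega)]; exact hs r (by omega))
    (by rw [Function.update_of_ne (by omega), hsi]) (by rw [Function.update_of_ne (by omega), hso])
  refine ((h₁.seq (h₂.seq (runs_escTo (a := N) (o := o) (k := N + 1) (by omega) (by omega)
    (by omega) _ ?_))).mono ?_).congr ?_
  · rw [Function.update_of_ne (by omega), Function.update_of_ne (by omega), hs _ (by omega)]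
  · have h₃ := hpl x
    simp [ho.ne']
    omega
  · rw [update_scratch (hs N le_rfl)]; simp [ho.ne', enc_prod]

@[fun_prop]
theorem PT.fst : PT (fun x : α × β => x.1) := by
  refine ⟨20 * Polynomial.X + 20, fun i o N hi ho hio => ?_⟩
  refine ⟨.seq (copy i N (N + 1)) (.seq (unesc N (N + 1) (N + 2)) (.seq (moveRev (N + 1) o)
    (clear N))), fun s x hs hsi hso => ?_⟩
  have h₁ := runs_copy (i := i) (o := N) (k := N + 1) (by omega) (by omega) (by omega) s
    (hs _ (by omega)) (hs _ le_rfl)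
  have h₂ := runs_unesc (a := N) (b := N + 1) (k := N + 2) (by omega) (by omega) (by omega)
    (enc x.1) (enc x.2) (Function.update s N (s i))
    (by rw [Function.update_of_ne (by omega)]; exact hs _ (by omega))
    (by rw [Function.update_of_ne (by omega)]; exact hs _ (by omega))
    (by rw [Function.update_self, hsi, enc_prod])
  refine ((h₁.seq (h₂.seq ((runs_moveRev (a := N + 1) (b := o) (by omega) _).seq
    (runs_clear N _)))).mono ?_).congr ?_
  · simp [ho.ne', hsi]
    omega
  · have h₃ := hs N le_rfl
    have h₄ := hs (N + 1) (by omega)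
    clear h₁ h₂ hs
    funext r
    simp only [Function.update_apply]
    split_ifs <;> first | omega | simp_all

@[fun_prop]
theorem PT.snd : PT (fun x : α × β => x.2) := by
  refine ⟨40 * Polynomial.X + 40, fun i o N hi ho hio => ?_⟩
  refine ⟨.seq (copy i N (N + 1)) (.seq (unesc N (N + 1) (N + 2)) (.seq (clear (N + 1))
    (move N o (N + 1)))), fun s x hs hsi hso => ?_⟩
  have h₁ := runs_copy (i := i) (o := N) (k := N + 1) (by omega) (by omega) (by omega) s
    (hs _ (by omega)) (hs _ le_rfl)
  have h₂ := runs_unesc (a := N) (b := N + 1) (k := N + 2) (by omega) (by omega) (by omega)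
    (enc x.1) (enc x.2) (Function.update s N (s i))
    (by rw [Function.update_of_ne (by omega)]; exact hs _ (by omega))
    (by rw [Function.update_of_ne (by omega)]; exact hs _ (by omega))
    (by rw [Function.update_self, hsi, enc_prod])
  refine ((h₁.seq (h₂.seq ((runs_clear (N + 1) _).seq
    (runs_move (a := N) (b := o) (k := N + 1) (by omega) (by omega) (by omega) _ ?_)))).mono
    ?_).congr ?_
  · simp
  · simp [hsi]
    omega
  · have h₃ := hs N le_rfl
    have h₄ := hs (N + 1) (by omega)
    clear h₁ h₂ hs
    funext r
    simp only [Function.update_apply]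
    split_ifs <;> first | omega | simp_all

/-- Concatenation of strings. -/
@[fun_prop]
theorem PT.string_append {f g : α → List Bool} (hf : PT f) (hg : PT g) :
    PT (fun x => f x ++ g x) := by
  obtain ⟨p, hpl, hp⟩ := hf.exists_bound
  obtain ⟨q, hq⟩ := hg.out
  refine ⟨9 * p + q + 2, fun i o N hi ho hio => ?_⟩
  obtain ⟨c, hc⟩ := hp i N (N + 1) (by omega) (by omega) (by omega)
  obtain ⟨d, hd⟩ := hq i o (N + 1) (by omega) (by omega) (by omega)
  refine ⟨.seq c (.seq d (move N o (N + 1))), fun s x hs hsi hso => ?_⟩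
  have h₁ := hc s x (fun r hr => hs r (by omega)) hsi (hs N le_rfl)
  have h₂ := hd (Function.update s N (enc (f x))) x
    (fun r hr => by rw [Function.update_of_ne (by omega)]; exact hs r (by omega))
    (by rw [Function.update_of_ne (by omega), hsi]) (by rw [Function.update_of_ne (by omega), hso])
  refine ((h₁.seq (h₂.seq (runs_move (a := N) (b := o) (k := N + 1) (by omega) (by omega)
    (by omega) _ ?_))).mono ?_).congr ?_
  · rw [Function.update_of_ne (by omega), Function.update_of_ne (by omega), hs _ (by omega)]
  · have h₃ := hpl x
    simp [ho.ne'] at h₃ ⊢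
    omega
  · rw [update_scratch (hs N le_rfl)]; simp [ho.ne']

@[fun_prop]
theorem PT.string_tail {f : α → List Bool} (hf : PT f) : PT (fun x => (f x).tail) := by
  obtain ⟨p, hp⟩ := hf.out
  refine ⟨p + 1, fun i o N hi ho hio => ?_⟩
  obtain ⟨c, hc⟩ := hp i o N hi ho hio
  refine ⟨.seq c (.popBit o), fun s x hs hsi hso => ?_⟩
  refine (((hc s x hs hsi hso).seq (runs_popBit o _)).mono ?_).congr ?_
  · simp
  · simp

/-- Branching according to the head of a string. -/
theorem PT.branch {t : α → List Bool} {f : α → β} {f₀ f₁ f₂ : α → β} (ht : PT t) (h₀ : PT f₀)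
    (h₁ : PT f₁) (h₂ : PT f₂) (e₀ : ∀ x, t x = [] → f x = f₀ x)
    (e₁ : ∀ x l, t x = false :: l → f x = f₁ x) (e₂ : ∀ x l, t x = true :: l → f x = f₂ x) :
    PT f := by
  obtain ⟨p, hpl, hp⟩ := ht.exists_bound
  obtain ⟨q₀, hq₀⟩ := h₀.out
  obtain ⟨q₁, hq₁⟩ := h₁.out
  obtain ⟨q₂, hq₂⟩ := h₂.out
  refine ⟨3 * p + q₀ + q₁ + q₂ + 2, fun i o N hi ho hio => ?_⟩
  obtain ⟨c, hc⟩ := hp i N (N + 1) (by omega) (by omega) (by omega)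
  obtain ⟨d₀, hd₀⟩ := hq₀ i o (N + 1) (by omega) (by omega) (by omega)
  obtain ⟨d₁, hd₁⟩ := hq₁ i o (N + 1) (by omega) (by omega) (by omega)
  obtain ⟨d₂, hd₂⟩ := hq₂ i o (N + 1) (by omega) (by omega) (by omega)
  refine ⟨.seq c (.seq (.branch N d₀ d₁ d₂) (clear N)), fun s x hs hsi hso => ?_⟩
  have h := hc s x (fun r hr => hs r (by omega)) hsi (hs N le_rfl)
  have hb : Runs (.branch N d₀ d₁ d₂) (Function.update s N (enc (t x)))
      (Function.update (Function.update s N (enc (t x))) o (enc (f x)))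
      ((q₀ + q₁ + q₂ + 1).eval (enc x).length) := by
    have a₁ : ∀ r, N + 1 ≤ r → Function.update s N (enc (t x)) r = [] :=
      fun r hr => by rw [Function.update_of_ne (by omega)]; exact hs r (by omega)
    have a₂ : Function.update s N (enc (t x)) i = enc x := by
      rw [Function.update_of_ne (by omega), hsi]
    have a₃ : Function.update s N (enc (t x)) o = [] := by
      rw [Function.update_of_ne (by omega), hso]
    rcases hl : t x with _ | ⟨_ | _, l⟩ <;> rw [hl] at a₁ a₂ a₃
    · rw [e₀ x hl]
      exact (Runs.branchEmpty (by simp) (hd₀ _ x a₁ a₂ a₃)).mono (by simp; omega)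
    · rw [e₁ x l hl]
      exact (Runs.branchFalse (l := l) (by simp) (hd₁ _ x a₁ a₂ a₃)).mono (by simp; omega)
    · rw [e₂ x l hl]
      exact (Runs.branchTrue (l := l) (by simp) (hd₂ _ x a₁ a₂ a₃)).mono (by simp)
  refine ((h.seq (hb.seq (runs_clear N _))).mono ?_).congr ?_
  · have h₃ := hpl x
    simp [ho.ne'] at h₃ ⊢
    omega
  · exact update_scratch' ho.ne (hs N le_rfl) _ _

theorem update_tail {N o : ℕ} (h : N ≠ o) (s : Store) (a b : List Bool) :
    Function.update (Function.update (Function.update s N a) o b) N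
      (Function.update (Function.update s N a) o b N).tail =
      Function.update (Function.update s N a.tail) o b := by
  funext r
  simp only [Function.update_apply]
  split_ifs <;> simp_all

theorem update_transfer {a o : ℕ} (h : a ≠ o) (s : Store) (e : List Bool) (ha : s a = []) :
    Function.update (Function.update (Function.update (Function.update s a e) o []) a []) o
      (Function.update (Function.update s a e) o [] a ++
        Function.update (Function.update s a e) o [] o) = Function.update s o e := by
  funext r
  simp only [Function.update_apply]
  split_ifs <;> simp_all

/-- Iteration, as long as the codes of the iterates remain polynomially bounded. -/
theorem PT.iterate {step : β → β} {init : α → β} {cnt : α → List Bool} (hs : PT step) (hi : PT init)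
    (hc : PT cnt) (q : Polynomial ℕ)
    (hq : ∀ x, ∀ j ≤ (cnt x).length, (enc (step^[j] (init x))).length ≤ q.eval (enc x).length) :
    PT (fun x => step^[(cnt x).length] (init x)) := by
  obtain ⟨ps, hsl, hps⟩ := hs.exists_bound
  obtain ⟨pi, hil, hpi⟩ := hi.exists_bound
  obtain ⟨pc, hcl, hpc⟩ := hc.exists_bound
  -- There are at most `pc` rounds. In a round the old value has length at most `q` and costs `2 *
  -- q` to erase; the new one has length at most `ps.comp q`, and computing and moving it costs nine
  -- times that.
  refine ⟨pc + pi + (pc * (9 * ps.comp q + 2 * q + 6) + 1), fun i o N hi ho hio => ?_⟩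
  obtain ⟨cc, hcc⟩ := hpc i N (N + 1) (by omega) (by omega) (by omega)
  obtain ⟨ci, hci⟩ := hpi i o (N + 1) (by omega) (by omega) (by omega)
  obtain ⟨cs, hcs⟩ := hps o (N + 1) (N + 2) (by omega) (by omega) (by omega)
  refine ⟨.seq cc (.seq ci (.loop N (.seq (.popBit N) (.seq cs (.seq (clear o)
    (move (N + 1) o (N + 2))))))), fun s x hsN hsi hso => ?_⟩
  have h₁ := hcc s x (fun r hr => hsN r (by omega)) hsi (hsN N le_rfl)
  have h₂ := hci (Function.update s N (enc (cnt x))) x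
    (fun r hr => by rw [Function.update_of_ne (by omega)]; exact hsN r (by omega))
    (by rw [Function.update_of_ne (by omega), hsi]) (by rw [Function.update_of_ne (by omega), hso])
  -- Loop invariant: after `j` rounds the counter on `N` has lost `j` bits and `o` holds the `j`-th
  -- iterate.
  have h₃ := runs_loop_of_forall (r := N) (c := .seq (.popBit N) (.seq cs (.seq (clear o)
    (move (N + 1) o (N + 2)))))
    (fun j => Function.update (Function.update s N ((cnt x).drop j)) o
      (enc (step^[j] (init x)))) (cnt x).length ((9 * ps.comp q + 2 * q + 5).eval (enc x).length)
    ?_ (by simp [ho.ne'])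
  · refine ((h₁.seq (h₂.seq h₃)).mono ?_).congr ?_
    · have h₄ := hcl x
      rw [enc_string] at h₄
      have h₅ := Nat.mul_le_mul_right
        ((9 * ps.comp q + 2 * q + 6).eval (enc x).length) h₄
      simp only [Polynomial.eval_add, Polynomial.eval_mul, Polynomial.eval_comp,
        Polynomial.eval_ofNat, Polynomial.eval_one] at h₅ ⊢
      linarith
    · have := hsN N le_rfl
      funext r
      simp only [Function.update_apply]
      split_ifs <;> simp_all
  · intro j hj
    have ho' := ho.ne
    refine ⟨by simp [ho.ne']; omega, ?_⟩
    have k₁ := runs_popBit N (Function.update (Function.update s N ((cnt x).drop j)) o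
      (enc (step^[j] (init x))))
    rw [update_tail ho.ne', List.tail_drop] at k₁
    have k₂ := hcs (Function.update (Function.update s N
      ((cnt x).drop (j + 1))) o (enc (step^[j] (init x)))) (step^[j] (init x)) (fun r hr => by
        rw [Function.update_of_ne (by omega), Function.update_of_ne (by omega)]
        exact hsN r (by omega)) (by simp) (by
        rw [Function.update_of_ne (by omega), Function.update_of_ne (by omega)]
        exact hsN _ (by omega))
    have k₃ := (k₁.seq (k₂.seq ((runs_clear o _).seq
      (runs_move (a := N + 1) (b := o) (k := N + 2) (by omega) (by omega) (by omega) _ (by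
        rw [Function.update_of_ne (by omega), Function.update_of_ne (by omega),
          Function.update_of_ne (by omega), Function.update_of_ne (by omega)]
        exact hsN _ (by omega))))))
    refine (k₃.mono ?_).congr ?_
    · have l₁ := hq x j hj.le
      have l₂ := hsl (step^[j] (init x))
      have l₃ := eval_mono ps l₁
      have : N + 1 ≠ o := by omega
      simp [this, this.symm]
      omega
    · rw [update_transfer (by omega), Function.update_idem, Function.iterate_succ_apply']
      rw [Function.update_of_ne (by omega), Function.update_of_ne (by omega)]
      exact hsN _ (by omega)

end


/-! ### Comparison with `PolyTime` -/

/-- The program that uses the stack `r + N` instead of `r`. -/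
def Program.shift (N : ℕ) : Program → Program
  | .skip => .skip
  | .pushBit r b => .pushBit (r + N) b
  | .popBit r => .popBit (r + N)
  | .seq c₁ c₂ => .seq (c₁.shift N) (c₂.shift N)
  | .branch r c₀ c₁ c₂ => .branch (r + N) (c₀.shift N) (c₁.shift N) (c₂.shift N)
  | .loop r c => .loop (r + N) (c.shift N)

/-- The store with `lo` below `N` and `s`, shifted, from `N` on. -/
def combine (N : ℕ) (lo s : Store) : Store := fun r => if r < N then lo r else s (r - N)

@[simp] theorem combine_add (N : ℕ) (lo s : Store) (r : ℕ) : combine N lo s (r + N) = s r := by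
  simp [combine]

theorem combine_update (N : ℕ) (lo s : Store) (r : ℕ) (l : List Bool) :
    combine N lo (Function.update s r l) = Function.update (combine N lo s) (r + N) l := by
  funext k
  by_cases hk : k < N
  · have : k ≠ r + N := by omega
    simp [combine, hk, Function.update_of_ne this]
  · obtain ⟨j, rfl⟩ : ∃ j, k = j + N := ⟨k - N, by omega⟩
    by_cases hj : j = r
    · subst hj; simp
    · have : j + N ≠ r + N := by omega
      simp [hj]

theorem Run.shift {c : Program} {s s' : Store} {t : ℕ} (h : Run c s s' t) (N : ℕ) (lo : Store) :
    Run (c.shift N) (combine N lo s) (combine N lo s') t := by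
  induction h with
  | skip s => exact .skip _
  | pushBit r b s =>
    rw [combine_update, ← combine_add N lo s r]
    exact .pushBit _ _ _
  | popBit r s =>
    rw [combine_update, ← combine_add N lo s r]
    exact .popBit _ _
  | seq _ _ ih₁ ih₂ => exact .seq ih₁ ih₂
  | branchEmpty hr _ ih => exact .branchEmpty (by simpa using hr) ih
  | branchFalse hr _ ih => exact .branchFalse (by simpa using hr) ih
  | branchTrue hr _ ih => exact .branchTrue (by simpa using hr) ih
  | loopStop hr => exact .loopStop (by simpa using hr)
  | loopStep hr _ _ ih₁ ih₂ => exact .loopStep (by simpa using hr) ih₁ ih₂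

/-- A bound for the stacks that a program names. -/
def Program.width : Program → ℕ
  | .skip => 0
  | .pushBit r _ => r + 1
  | .popBit r => r + 1
  | .seq c₁ c₂ => max c₁.width c₂.width
  | .branch r c₀ c₁ c₂ => max (r + 1) (max c₀.width (max c₁.width c₂.width))
  | .loop r c => max (r + 1) c.width

/-- A program of unknown origin may leave garbage behind. This confines the garbage to finitely many
known stacks, which can then be cleared. -/
theorem Run.eq_of_width_le {c : Program} {s s' : Store} {t : ℕ} (h : Run c s s' t) {r : ℕ}
    (hr : c.width ≤ r) : s' r = s r := by
  induction h with
  | skip s => rfl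
  | pushBit r' b s =>
    simp only [Program.width] at hr
    exact Function.update_of_ne (by omega) _ _
  | popBit r' s =>
    simp only [Program.width] at hr
    exact Function.update_of_ne (by omega) _ _
  | seq _ _ ih₁ ih₂ =>
    simp only [Program.width, max_le_iff] at hr
    exact (ih₂ hr.2).trans (ih₁ hr.1)
  | branchEmpty _ _ ih =>
    simp only [Program.width, max_le_iff] at hr
    exact ih hr.2.1
  | branchFalse _ _ ih =>
    simp only [Program.width, max_le_iff] at hr
    exact ih hr.2.2.1
  | branchTrue _ _ ih =>
    simp only [Program.width, max_le_iff] at hr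
    exact ih hr.2.2.2
  | loopStop _ => rfl
  | loopStep _ _ _ ih₁ ih₂ =>
    have hr' := hr
    simp only [Program.width, max_le_iff] at hr
    exact (ih₂ hr').trans (ih₁ hr.2)

/-- Empty the stacks `a, …, a + n - 1`. -/
def clearRange (a : ℕ) : ℕ → Program
  | 0 => .skip
  | n + 1 => .seq (clearRange a n) (clear (a + n))

theorem runs_clearRange (a n L : ℕ) (s : Store) 
    (hL : ∀ r, a ≤ r → r < a + n → (s r).length ≤ L) :
    Runs (clearRange a n) s (fun r => if a ≤ r ∧ r < a + n then [] else s r)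
      (n * (2 * L + 1) + 1) := by
  induction n with
  | zero => exact ((runs_skip s).mono (by omega)).congr (by funext r; simp)
  | succ n ih =>
    refine (((ih fun r h₁ h₂ => hL r h₁ (by omega)).seq (runs_clear (a + n) _)).mono ?_).congr ?_
    · have := hL (a + n) (by omega) (by omega)
      simp only [lt_self_iff_false, and_false, if_false]
      rw [show (n + 1) * (2 * L + 1) = n * (2 * L + 1) + (2 * L + 1) from Nat.succ_mul _ _]
      omega
    · funext r
      by_cases h : r = a + n
      · subst h; simp
      · rw [Function.update_of_ne h]
        have : (a ≤ r ∧ r < a + n) ↔ (a ≤ r ∧ r < a + (n + 1)) := by omega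
        simp only [this]

theorem length_initialStore_le {a : ℕ} (v : Fin a → List Bool) (r : ℕ) :
    (initialStore v r).length ≤ ∑ i, (v i).length := by
  unfold initialStore
  split_ifs with h
  · exact Finset.single_le_sum (f := fun i => (v i).length) (fun _ _ => Nat.zero_le _)
      (Finset.mem_univ (⟨r, h⟩ : Fin a))
  · simp

/-- A polynomial-time program can be run in the scratch space of another program. -/
theorem PolyTime.runs_combine {a : ℕ} {F : (Fin a → List Bool) → List Bool} (hF : PolyTime F) :
    ∃ p : Polynomial ℕ, ∀ o N : ℕ, o < N → ∃ d : Program, ∀ (s : Store) (v : Fin a → List Bool),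
      (∀ r, N ≤ r → s r = []) → s o = [] →
      Runs d (combine N s (initialStore v)) (Function.update s o (F v))
        (p.eval (∑ i, (v i).length)) := by
  obtain ⟨c, p, hc⟩ := hF
  -- From `W` on, all stacks of `c` are empty at the end: they are neither named by `c` nor do they
  -- hold an argument. So `N + W` can be the scratch stack of the final move.
  obtain ⟨W, hW⟩ : ∃ W, W = c.width + a + 1 := ⟨_, rfl⟩
  refine ⟨p + (8 * (Polynomial.X + p) + 2) +
    ((W : Polynomial ℕ) * (2 * (2 * Polynomial.X + 2 * p) + 1) + 1), fun o N ho =>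
    ⟨.seq (c.shift N) (.seq (move N o (N + W)) (clearRange N W)), fun s v hs hso => ?_⟩⟩
  obtain ⟨s', t, hr, ht, hF⟩ := hc v
  have hout : ∀ r, W ≤ r → s' r = [] := fun r h => by
    rw [hr.eq_of_width_le (by omega), initialStore, dif_neg (by omega)]
  have hlen : ∀ r, (s' r).length ≤ ∑ i, (v i).length + p.eval (∑ i, (v i).length) := fun r =>
    (hr.length_le r).trans (Nat.add_le_add (length_initialStore_le v r) ht)
  have hN : combine N s s' N = F v := by simp [combine, hF]
  have h₁ : Runs (c.shift N) (combine N s (initialStore v)) (combine N s s') _ :=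
    ⟨t, ht, hr.shift N s⟩
  have h₂ := runs_move (a := N) (b := o) (k := N + W) (by omega) (by omega) (by omega)
    (combine N s s') (by simp [combine, hout])
  have h₃ := runs_clearRange N W (2 * (∑ i, (v i).length) + 2 * p.eval (∑ i, (v i).length))
    (Function.update (Function.update (combine N s s') N []) o
      (combine N s s' N ++ combine N s s' o)) (fun r hrN _ => by
      have := hlen (r - N)
      rw [Function.update_of_ne (by omega)]
      simp only [Function.update_apply]
      split_ifs
      · simp
      · simp only [combine, not_lt.mpr hrN, if_false]
        omega)
  refine ((h₁.seq (h₂.seq h₃)).mono ?_).congr ?_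
  · have h₀ := hlen 0
    rw [hF] at h₀
    rw [hN]
    simp only [Polynomial.eval_add, Polynomial.eval_mul, Polynomial.eval_ofNat, Polynomial.eval_X,
      Polynomial.eval_one, Polynomial.eval_natCast, Nat.cast_id]
    rw [← mul_add]
    omega
  · funext r
    rw [hN]
    by_cases hro : r = o
    · subst hro
      rw [if_neg (by omega)]
      simp [combine, ho, hso]
    · rw [Function.update_of_ne hro, Function.update_of_ne hro]
      by_cases hrN : r < N
      · rw [if_neg (by omega), Function.update_of_ne (by omega)]
        simp [combine, hrN]
      · rw [hs r (by omega)]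
        split_ifs with h
        · rfl
        · rw [Function.update_of_ne (by omega)]
          simp only [combine, hrN, if_false]
          exact hout _ (by omega)

/-- Copying the argument to the stack `N` produces exactly the initial store of the program shifted
by `N`, since all scratch stacks are empty. -/
theorem PT.of_polyTime₁ {f : List Bool → List Bool} (hf : PolyTime₁ f) : PT f := by
  obtain ⟨p, hp⟩ := PolyTime.runs_combine hf
  refine ⟨9 * Polynomial.X + 2 + p, fun i o N hi ho hio => ?_⟩
  obtain ⟨d, hd⟩ := hp o N ho
  refine ⟨.seq (copy i N (N + 1)) d, fun s x hs hsi hso => ?_⟩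
  have h₁ := runs_copy (i := i) (o := N) (k := N + 1) (by omega) (by omega) (by omega) s
    (hs _ (by omega)) (hs _ le_rfl)
  have e : Function.update s N (s i) = combine N s (initialStore fun _ : Fin 1 => x) := by
    funext r
    by_cases hr : r < N
    · rw [Function.update_of_ne (by omega)]
      simp [combine, hr]
    · by_cases hr' : r = N
      · subst hr'
        simp [combine, initialStore, hsi]
      · rw [Function.update_of_ne hr', hs r (by omega)]
        simp only [combine, hr, if_false, initialStore]
        rw [dif_neg (by omega)]
  rw [e] at h₁
  exact (h₁.seq (hd s (fun _ => x) hs hso)).mono (by simp [hsi])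

theorem PT.of_polyTime₂ {g : List Bool → List Bool → List Bool} (hg : PolyTime₂ g) :
    PT (fun x : List Bool × List Bool => g x.1 x.2) := by
  obtain ⟨p, hp⟩ := PolyTime.runs_combine hg
  obtain ⟨p₁, hp₁⟩ := (PT.fst : PT (fun x : List Bool × List Bool => x.1))
  obtain ⟨p₂, hp₂⟩ := (PT.snd : PT (fun x : List Bool × List Bool => x.2))
  refine ⟨p₁ + p₂ + p, fun i o N hi ho hio => ?_⟩
  obtain ⟨d, hd⟩ := hp o N ho
  obtain ⟨c₁, hc₁⟩ := hp₁ i N (N + 1) (by omega) (by omega) (by omega)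
  obtain ⟨c₂, hc₂⟩ := hp₂ i (N + 1) (N + 2) (by omega) (by omega) (by omega)
  refine ⟨.seq c₁ (.seq c₂ d), fun s x hs hsi hso => ?_⟩
  have h₁ := hc₁ s x (fun r hr => hs r (by omega)) hsi (hs N le_rfl)
  have h₂ := hc₂ (Function.update s N (enc x.1)) x
    (fun r hr => by rw [Function.update_of_ne (by omega)]; exact hs r (by omega))
    (by rw [Function.update_of_ne (by omega), hsi])
    (by rw [Function.update_of_ne (by omega)]; exact hs _ (by omega))
  have e : Function.update (Function.update s N (enc x.1)) (N + 1) (enc x.2) =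
      combine N s (initialStore ![x.1, x.2]) := by
    funext r
    by_cases hr : r < N
    · rw [Function.update_of_ne (by omega), Function.update_of_ne (by omega)]
      simp [combine, hr]
    · obtain ⟨j, rfl⟩ : ∃ j, r = N + j := ⟨r - N, by omega⟩
      obtain rfl | rfl | hj : j = 0 ∨ j = 1 ∨ 2 ≤ j := by omega
      · simp [combine, initialStore]
      · simp [combine, initialStore]
      · rw [Function.update_of_ne (by omega), Function.update_of_ne (by omega), hs _ (by omega)]
        simp only [combine, hr, if_false, initialStore]
        rw [dif_neg (by omega)]
  rw [e] at h₂
  refine (h₁.seq (h₂.seq (hd s ![x.1, x.2] hs hso))).mono ?_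
  have := eval_mono p (show x.1.length + x.2.length ≤ 2 * x.1.length + 1 + x.2.length by omega)
  simp at this ⊢
  omega

/-- Stack `0` holds the argument at the start and must hold the value at the end, so the value is
computed on stack `1` and moved. -/
theorem PT.polyTime₁ {f : List Bool → List Bool} (hf : PT f) : PolyTime₁ f := by
  obtain ⟨p, hpl, hp⟩ := hf.exists_bound
  obtain ⟨c, hc⟩ := hp 0 1 2 (by omega) (by omega) (by omega)
  refine ⟨.seq c (.seq (clear 0) (move 1 0 2)), p + (2 * Polynomial.X + 1) + (8 * p + 2),
    fun v => ?_⟩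
  have h₁ := hc (initialStore v) (v 0) (fun r hr => by simp [initialStore]; omega)
    (by simp [initialStore]) (by simp [initialStore])
  have h₂ := h₁.seq ((runs_clear 0 _).seq (runs_move (a := 1) (b := 0) (k := 2) (by omega)
    (by omega) (by omega) _ (by simp [initialStore])))
  obtain ⟨t, ht, hr⟩ := h₂
  refine ⟨_, t, hr, ht.trans ?_, by simp⟩
  have := hpl (v 0)
  simp [initialStore] at this ⊢
  omega

theorem PT.polyTime₂ {g : List Bool → List Bool → List Bool}
    (hg : PT (fun x : List Bool × List Bool => g x.1 x.2)) : PolyTime₂ g := by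
  obtain ⟨p, hp⟩ := hg
  obtain ⟨c, hc⟩ := hp 2 0 3 (by omega) (by omega) (by omega)
  -- The code of the pair of arguments is assembled on stack `2`; emptying stack `0` in passing
  -- makes it available for the output.
  refine ⟨.seq (copy 1 2 3) (.seq (escTo 0 2 3) c),
    (9 * Polynomial.X + 2) + (9 * Polynomial.X + 3) + p.comp (2 * Polynomial.X + 1), fun v => ?_⟩
  have h₁ := runs_copy (i := 1) (o := 2) (k := 3) (by omega) (by omega) (by omega)
    (initialStore v) (by simp [initialStore]) (by simp [initialStore])
  have h₂ := runs_escTo (a := 0) (o := 2) (k := 3) (by omega) (by omega) (by omega)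
    (Function.update (initialStore v) 2 (initialStore v 1)) (by simp [initialStore])
  have h₃ := hc (Function.update (Function.update (Function.update (initialStore v) 2
    (initialStore v 1)) 0 []) 2 (esc (v 0) ++ v 1)) (v 0, v 1)
    (fun r hr => by
      simp only [Function.update_apply, initialStore]
      split_ifs <;> first | omega | rfl) (by simp [enc_prod]) (by simp)
  have e : Function.update (Function.update (Function.update (initialStore v) 2
      (initialStore v 1)) 0 []) 2 (esc (Function.update (initialStore v) 2 (initialStore v 1) 0) ++
      Function.update (initialStore v) 2 (initialStore v 1) 2) =
      Function.update (Function.update (Function.update (initialStore v) 2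
    (initialStore v 1)) 0 []) 2 (esc (v 0) ++ v 1) := by simp [initialStore]
  rw [e] at h₂
  obtain ⟨t, ht, hr⟩ := h₁.seq (h₂.seq h₃)
  refine ⟨_, t, hr, ht.trans ?_, by simp⟩
  have := eval_mono p (show 2 * (v 0).length + 1 + (v 1).length ≤
    2 * ((v 0).length + (v 1).length) + 1 by omega)
  simp [initialStore] at this ⊢
  omega


/-! ### A library of polynomial-time functions -/

section
variable {α β γ δ : Type} [Code α] [Code β] [Code γ] [Code δ]

theorem PT.to_enc {f : α → β} (hf : PT f) : PT (fun x => enc (f x)) :=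
  hf.recode (fun x => x) (fun _ => rfl) (fun _ => rfl)

theorem PT.of_enc {f : α → β} (hf : PT (fun x => enc (f x))) : PT f :=
  hf.recode (fun x => x) (fun _ => rfl) (fun _ => rfl)

@[fun_prop]
theorem PT.fst' {f : α → β × γ} (hf : PT f) : PT (fun x => (f x).1) := PT.fst.comp hf

@[fun_prop]
theorem PT.snd' {f : α → β × γ} (hf : PT f) : PT (fun x => (f x).2) := PT.snd.comp hf

@[fun_prop]
theorem PT.ite {t : α → Bool} {f g : α → β} (ht : PT t) (hf : PT f) (hg : PT g) :
    PT (fun x => if t x = true then f x else g x) := by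
  -- The string `[t x]` is never empty, so the function given for the empty case is arbitrary.
  refine PT.branch (t := fun x => [t x]) ht.to_enc hf hg hf (by simp) ?_ ?_
  · intro x l h; simp_all
  · intro x l h; simp_all

@[fun_prop]
theorem PT.not {t : α → Bool} (ht : PT t) : PT (fun x => !(t x)) :=
  (ht.ite (PT.const false) (PT.const true)).congr fun x => by cases t x <;> rfl

@[fun_prop]
theorem PT.and {t u : α → Bool} (ht : PT t) (hu : PT u) : PT (fun x => t x && u x) :=
  (ht.ite hu (PT.const false)).congr fun x => by cases t x <;> rfl

@[fun_prop]
theorem PT.bool_beq {t u : α → Bool} (ht : PT t) (hu : PT u) : PT (fun x => t x == u x) :=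
  (ht.ite hu hu.not).congr fun x => by cases t x <;> cases u x <;> rfl

@[fun_prop]
theorem PT.string_cons {t : α → Bool} {f : α → List Bool} (ht : PT t) (hf : PT f) :
    PT (fun x => t x :: f x) :=
  ht.to_enc.string_append hf

@[fun_prop]
theorem PT.string_headD {f : α → List Bool} (hf : PT f) : PT (fun x => (f x).headD false) := by
  refine PT.branch hf (PT.const false) (PT.const false) (PT.const true) ?_ ?_ ?_
  all_goals simp +contextual

@[fun_prop]
theorem PT.string_isEmpty {f : α → List Bool} (hf : PT f) : PT (fun x => (f x).isEmpty) := by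
  refine PT.branch hf (PT.const true) (PT.const false) (PT.const false) ?_ ?_ ?_
  all_goals simp +contextual

/-! #### Natural numbers -/

@[fun_prop]
theorem PT.add {f g : α → ℕ} (hf : PT f) (hg : PT g) : PT (fun x => f x + g x) :=
  PT.of_enc ((hf.to_enc.string_append hg.to_enc).congr fun x => by
    simp [enc_nat])

@[fun_prop]
theorem PT.pred {f : α → ℕ} (hf : PT f) : PT (fun x => (f x).pred) :=
  PT.of_enc (hf.to_enc.string_tail.congr fun x => by simp [enc_nat])

@[fun_prop]
theorem PT.nat_eq_zero {f : α → ℕ} (hf : PT f) : PT (fun x => f x == 0) :=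
  hf.to_enc.string_isEmpty.congr fun x => by cases h : f x <;> simp [enc_nat, List.replicate_succ]

/-- Iteration a number of times that is given in unary. -/
theorem PT.iterate_nat {step : β → β} {init : α → β} {cnt : α → ℕ} (hs : PT step) (hi : PT init)
    (hc : PT cnt) (q : Polynomial ℕ)
    (hq : ∀ x, ∀ j ≤ cnt x, (enc (step^[j] (init x))).length ≤ q.eval (enc x).length) :
    PT (fun x => step^[cnt x] (init x)) :=
  (PT.iterate hs hi hc.to_enc q (by simpa using hq)).congr fun x => by simp

@[fun_prop]
theorem PT.mul {f g : α → ℕ} (hf : PT f) (hg : PT g) : PT (fun x => f x * g x) := by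
  obtain ⟨p, hp, -⟩ := hf.exists_bound
  obtain ⟨q, hq, -⟩ := hg.exists_bound
  have hs : ∀ (a j : ℕ), (fun y : ℕ × ℕ => (y.1, y.2 + y.1))^[j] (a, 0) = (a, j * a) := by
    intro a j
    induction j with
    | zero => simp
    | succ j ih => rw [Function.iterate_succ_apply', ih]; simp [Nat.succ_mul]
  have := PT.iterate_nat (step := fun y : ℕ × ℕ => (y.1, y.2 + y.1)) (by fun_prop)
    (init := fun x => (g x, 0)) (by fun_prop) hf (2 * q + 1 + p * q) (fun x j hj => by
      rw [hs]
      have h₁ := hp x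
      have h₂ := hq x
      simp at h₁ h₂ ⊢
      nlinarith [Nat.mul_le_mul (hj.trans h₁) h₂])
  exact (PT.snd.comp this).congr fun x => by rw [hs]

@[fun_prop]
theorem PT.pow {f : α → ℕ} (hf : PT f) (e : ℕ) : PT (fun x => f x ^ e) := by
  induction e with
  | zero => simpa using PT.const 1
  | succ e ih => exact (ih.mul hf).congr fun x => (pow_succ _ _).symm

/-- Division by two as repeated subtraction of `2`: the state is (quotient, rest), and it is
stationary once the rest is at most `1`. Surplus rounds therefore do no harm, and the number itself
can serve as the counter. -/
theorem iterate_halve (j q r : ℕ) (hj : r ≤ j) :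
    (fun y : ℕ × ℕ => if (y.2.pred == 0) = true then y else (y.1 + 1, y.2.pred.pred))^[j] (q, r) =
      (q + r / 2, r % 2) := by
  induction j generalizing q r with
  | zero => obtain rfl : r = 0 := by omega
            simp
  | succ j ih =>
    rw [Function.iterate_succ_apply]
    by_cases h : r.pred = 0
    · simp only [h, beq_self_eq_true, if_true]
      have hr : r = 0 ∨ r = 1 := by have := Nat.pred_eq_sub_one (n := r); omega
      by_cases hj' : r ≤ j
      · exact ih q r hj'
      · obtain ⟨rfl, rfl⟩ : j = 0 ∧ r = 1 := by omega
        simp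
    · have h' : (r.pred == 0) = false := by simpa using h
      simp only [h', Bool.false_eq_true, if_false]
      rw [Nat.pred_eq_sub_one] at h
      rw [ih _ _ (by simp only [Nat.pred_eq_sub_one]; omega)]
      simp only [Nat.pred_eq_sub_one, Prod.mk.injEq]
      omega

/-- A round adds `1` to the quotient and takes `2` from the rest, so the sum does not grow. This
supplies the size bound that `PT.iterate_nat` requires. -/
theorem iterate_halve_le (j q r : ℕ) :
    ((fun y : ℕ × ℕ => if (y.2.pred == 0) = true then y else (y.1 + 1, y.2.pred.pred))^[j]
      (q, r)).1 + ((fun y : ℕ × ℕ => if (y.2.pred == 0) = true then y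
        else (y.1 + 1, y.2.pred.pred))^[j] (q, r)).2 ≤ q + r := by
  induction j with
  | zero => simp
  | succ j ih =>
    rw [Function.iterate_succ_apply']
    generalize (fun y : ℕ × ℕ => if (y.2.pred == 0) = true then y
        else (y.1 + 1, y.2.pred.pred))^[j] (q, r) = z at ih ⊢
    by_cases h : z.2.pred = 0
    · have h' : (z.2.pred == 0) = true := by simpa using h
      simpa only [h', if_true] using ih
    · have h' : (z.2.pred == 0) = false := by simpa using h
      simp only [h', Bool.false_eq_true, if_false]
      simp only [Nat.pred_eq_sub_one] at h ⊢
      omega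

theorem PT.div_mod_two {f : α → ℕ} (hf : PT f) : PT (fun x => (f x / 2, f x % 2)) := by
  obtain ⟨p, hp, -⟩ := hf.exists_bound
  refine (PT.iterate_nat (step := fun y : ℕ × ℕ => if (y.2.pred == 0) = true then y
    else (y.1 + 1, y.2.pred.pred)) (by fun_prop) (init := fun x => (0, f x)) (by fun_prop) hf
    (2 * p + 1) (fun x j hj => ?_)).congr fun x => ?_
  · have h₁ := hp x
    have h₂ := iterate_halve_le j 0 (f x)
    simp at h₁ h₂ ⊢
    omega
  · rw [iterate_halve _ _ _ le_rfl]; simp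

@[fun_prop]
theorem PT.testBit {f g : α → ℕ} (hf : PT f) (hg : PT g) : PT (fun x => (f x).testBit (g x)) := by
  obtain ⟨p, hp, -⟩ := hf.exists_bound
  have hs : ∀ j n : ℕ, (fun m => m / 2)^[j] n = n >>> j := by
    intro j n
    induction j with
    | zero => rfl
    | succ j ih => rw [Function.iterate_succ_apply', ih, Nat.shiftRight_succ]
  have h := PT.iterate_nat (step := fun n => n / 2) (PT.fst.comp PT.id.div_mod_two) hf hg p
    (fun x j _ => by
      rw [hs, length_enc_nat]
      have h₁ := hp x
      rw [length_enc_nat] at h₁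
      exact (Nat.shiftRight_le _ _).trans h₁)
  refine ((PT.snd.comp h.div_mod_two).nat_eq_zero.not).congr fun x => ?_
  rw [hs, Nat.testBit, Nat.and_comm, Nat.and_one_is_mod]
  rfl

/-! #### Lists -/

@[fun_prop]
theorem PT.append [Item β] {f g : α → List β} (hf : PT f) (hg : PT g) : PT (fun x => f x ++ g x) :=
  PT.of_enc ((hf.to_enc.string_append hg.to_enc).congr fun x => by rw [enc_append])

@[fun_prop]
theorem PT.cons [Item β] {f : α → β} {g : α → List β} (hf : PT f) (hg : PT g) :
    PT (fun x => f x :: g x) :=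
  PT.of_enc ((hf.pair hg).to_enc.congr fun _ => rfl)

@[fun_prop]
theorem PT.isEmpty [Item β] {f : α → List β} (hf : PT f) : PT (fun x => (f x).isEmpty) :=
  hf.to_enc.string_isEmpty.congr fun x => by
    rcases f x with _ | ⟨a, l⟩
    · rfl
    · simp [enc_cons, esc]

/-- The code of `a :: l` is literally the code of the pair `(a, l)`, so only the empty list requires
any work. -/
theorem PT.uncons [Item γ] (d : γ) : PT (fun l : List γ => (l.headD d, l.tail)) := by
  have hU : PT (fun s : List Bool => if s.isEmpty = true then enc (d, ([] : List γ)) else s) := by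
    fun_prop
  refine hU.recode enc (fun _ => rfl) fun l => ?_
  rcases l with _ | ⟨a, l⟩
  · rfl
  · rw [if_neg (by simp [enc_cons, esc])]; rfl

@[fun_prop]
theorem PT.headD [Item γ] {f : α → List γ} (hf : PT f) (d : γ) : PT (fun x => (f x).headD d) :=
  PT.fst.comp ((PT.uncons d).comp hf)

@[fun_prop]
theorem PT.tail [Item γ] [Inhabited γ] {f : α → List γ} (hf : PT f) : PT (fun x => (f x).tail) :=
  PT.snd.comp ((PT.uncons default).comp hf)

theorem length_enc_drop_le [Item γ] (l : List γ) (j : ℕ) :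
    (enc (l.drop j)).length ≤ (enc l).length := by
  conv_rhs => rw [← List.take_append_drop j l, length_enc_append]
  omega

theorem length_le_length_enc [Item γ] (l : List γ) : l.length ≤ (enc l).length := by
  induction l with
  | nil => simp
  | cons a l ih => simp; omega

theorem length_enc_le_of_mem [Item γ] {l : List γ} {a : γ} (h : a ∈ l) :
    (enc a).length ≤ (enc l).length := by
  obtain ⟨l₁, l₂, rfl⟩ := List.append_of_mem h
  simp
  omega

theorem length_enc_le_of_forall [Item γ] {l : List γ} {B : ℕ}
    (h : ∀ a ∈ l, (enc a).length ≤ B) : (enc l).length ≤ l.length * (2 * B + 1) := by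
  induction l with
  | nil => simp
  | cons a l ih =>
    have h₁ := h a (by simp)
    have h₂ := ih fun b hb => h b (by simp [hb])
    rw [length_enc_cons, List.length_cons, Nat.add_mul, Nat.one_mul]
    omega

/-- Folding over a list, as long as the codes of the intermediate values remain polynomially
bounded. -/
theorem PT.foldl [Item γ] [Inhabited γ] {l : α → List γ} {init : α → β} {F : α → β → γ → β}
    (hl : PT l) (hi : PT init) (hF : PT (fun p : α × β × γ => F p.1 p.2.1 p.2.2))
    (q : Polynomial ℕ) (hq : ∀ x j,
      (enc (((l x).take j).foldl (F x) (init x))).length ≤ q.eval (enc x).length) :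
    PT (fun x => (l x).foldl (F x) (init x)) := by
  obtain ⟨p, hp, -⟩ := hl.exists_bound
  -- The fold is an iteration on triples (parameter, accumulator, remaining list) that stops
  -- changing when the list is used up. It can thus be run as many times as the code of the list has
  -- bits, which is at least the length of the list.
  have hs : ∀ (x : α) (j : ℕ) (s : β) (l : List γ),
      (fun y : α × β × List γ => if y.2.2.isEmpty = true then y
        else (y.1, F y.1 y.2.1 (y.2.2.headD default), y.2.2.tail))^[j] (x, s, l) =
        (x, (l.take j).foldl (F x) s, l.drop j) := by
    intro x j s l
    induction j generalizing s l with
    | zero => rfl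
    | succ j ih =>
      rw [Function.iterate_succ_apply]
      rcases l with _ | ⟨a, l⟩
      · simpa using ih s []
      · simpa using ih (F x s a) l
  have hF' : PT (fun y : α × β × List γ => F y.1 y.2.1 (y.2.2.headD default)) :=
    hF.comp (f := fun y : α × β × List γ => (y.1, y.2.1, y.2.2.headD default)) (by fun_prop)
  have h := PT.iterate (step := fun y : α × β × List γ => if y.2.2.isEmpty = true then y
        else (y.1, F y.1 y.2.1 (y.2.2.headD default), y.2.2.tail)) (by fun_prop)
    (init := fun x => (x, init x, l x)) (by fun_prop) hl.to_enc
    (2 * Polynomial.X + 2 * q + p + 2) (fun x j hj => by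
      rw [hs]
      have h₁ := hq x j
      have h₂ := (length_enc_drop_le (l x) j).trans (hp x)
      simp
      omega)
  refine (PT.fst.comp (PT.snd.comp h)).congr fun x => ?_
  rw [hs, List.take_of_length_le (length_le_length_enc _)]

theorem foldl_append_eq {σ τ : Type} (f : σ → List τ) (l : List σ) (s : List τ) :
    l.foldl (fun s a => s ++ f a) s = s ++ l.flatMap f := by
  induction l generalizing s with
  | nil => simp
  | cons a l ih => simp [ih]

theorem length_flatMap_le {σ τ : Type} (f : σ → List τ) (l : List σ) (B : ℕ)
    (h : ∀ a ∈ l, (f a).length ≤ B) : (l.flatMap f).length ≤ l.length * B := by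
  induction l with
  | nil => simp
  | cons a l ih =>
    have h₁ := h a (by simp)
    have h₂ := ih fun b hb => h b (by simp [hb])
    simp only [List.flatMap_cons, List.length_append, List.length_cons, Nat.succ_mul]
    omega

theorem PT.flatMap_string [Item γ] [Inhabited γ] {l : α → List γ} {F : α → γ → List Bool}
    (hl : PT l) (hF : PT (fun p : α × γ => F p.1 p.2)) : PT (fun x => (l x).flatMap (F x)) := by
  obtain ⟨p, hp, -⟩ := hl.exists_bound
  obtain ⟨q, hq, -⟩ := hF.exists_bound
  have hF' : PT (fun y : α × List Bool × γ => F y.1 y.2.2) :=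
    hF.comp (f := fun y : α × List Bool × γ => (y.1, y.2.2)) (by fun_prop)
  refine (PT.foldl hl (PT.const ([] : List Bool)) (F := fun x s a => s ++ F x a) (by fun_prop)
    (p * q.comp (2 * Polynomial.X + 1 + p)) (fun x j => ?_)).congr fun x => ?_
  · rw [foldl_append_eq, List.nil_append, enc_string]
    refine (length_flatMap_le _ _ (q.eval (2 * (enc x).length + 1 + p.eval (enc x).length))
      fun a ha => ?_).trans ?_
    · refine (hq (x, a)).trans (eval_mono q ?_)
      have := (length_enc_le_of_mem (List.mem_of_mem_take ha)).trans (hp x)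
      simp
      omega
    · have h₁ := (length_le_length_enc (l x)).trans (hp x)
      simp only [Polynomial.eval_mul, Polynomial.eval_comp, Polynomial.eval_add,
        Polynomial.eval_ofNat, Polynomial.eval_one, Polynomial.eval_X]
      refine Nat.mul_le_mul_right _ (le_trans ?_ h₁)
      simp
  · rw [foldl_append_eq, List.nil_append]

theorem enc_flatMap {σ : Type} [Item δ] (l : List σ) (f : σ → List δ) :
    enc (l.flatMap f) = l.flatMap fun a => enc (f a) := by
  induction l with
  | nil => rfl
  | cons a l ih => simp [enc_append, ih]

theorem PT.flatMap [Item γ] [Inhabited γ] [Item δ] {l : α → List γ} {F : α → γ → List δ}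
    (hl : PT l) (hF : PT (fun p : α × γ => F p.1 p.2)) : PT (fun x => (l x).flatMap (F x)) :=
  PT.of_enc ((PT.flatMap_string hl hF.to_enc).congr fun x => by rw [enc_flatMap])

theorem PT.map [Item γ] [Inhabited γ] [Item δ] {l : α → List γ} {F : α → γ → δ}
    (hl : PT l) (hF : PT (fun p : α × γ => F p.1 p.2)) : PT (fun x => (l x).map (F x)) :=
  (PT.flatMap hl (F := fun x a => [F x a]) (hF.cons (PT.const []))).congr fun x => by
    simp [List.map_eq_flatMap]

@[fun_prop]
theorem PT.length [Item γ] [Inhabited γ] {l : α → List γ} (hl : PT l) :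
    PT (fun x => (l x).length) :=
  PT.of_enc ((PT.flatMap_string hl (F := fun _ _ => [true]) (PT.const _)).congr fun x => by
    induction l x with
    | nil => rfl
    | cons a l ih => simp [ih, enc_nat, List.replicate_succ])

@[fun_prop]
theorem PT.range {f : α → ℕ} (hf : PT f) : PT (fun x => List.range (f x)) := by
  obtain ⟨p, hp, -⟩ := hf.exists_bound
  have hs : ∀ j, (fun y : ℕ × List ℕ => (y.1 + 1, y.2 ++ [y.1]))^[j] (0, []) =
      (j, List.range j) := by
    intro j
    induction j with
    | zero => rfl
    | succ j ih => rw [Function.iterate_succ_apply', ih, List.range_succ]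
  refine (PT.snd.comp (PT.iterate_nat (step := fun y : ℕ × List ℕ => (y.1 + 1, y.2 ++ [y.1]))
    (by fun_prop) (init := fun _ => (0, [])) (by fun_prop) hf (2 * p + 1 + p * (2 * p + 1))
    (fun x j hj => ?_))).congr fun x => ?_
  · rw [hs]
    have h₁ := hp x
    rw [length_enc_nat] at h₁
    have h₂ := length_enc_le_of_forall (l := List.range j) (B := p.eval (enc x).length)
      (fun a ha => by simp at ha ⊢; omega)
    have h₄ := hj.trans h₁
    have h₃ := Nat.mul_le_mul_right (2 * p.eval (enc x).length + 1) h₄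
    simp at h₂ ⊢
    omega
  · rw [hs]

theorem getD_eq_headD_drop {σ : Type} (l : List σ) (i : ℕ) (d : σ) :
    l.getD i d = (l.drop i).headD d := by
  rw [List.getD_eq_getElem?_getD, List.headD_eq_head?_getD, List.head?_drop]

theorem iterate_tail {σ : Type} (l : List σ) (j : ℕ) : List.tail^[j] l = l.drop j := by
  induction j with
  | zero => rfl
  | succ j ih => rw [Function.iterate_succ_apply', ih, List.tail_drop]

@[fun_prop]
theorem PT.string_drop {l : α → List Bool} {f : α → ℕ} (hl : PT l) (hf : PT f) :
    PT (fun x => (l x).drop (f x)) := by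
  obtain ⟨p, hp, -⟩ := hl.exists_bound
  refine (PT.iterate_nat (step := List.tail) PT.id.string_tail hl hf p
    (fun x j hj => ?_)).congr fun x => iterate_tail _ _
  have := hp x
  rw [iterate_tail]
  simp at this ⊢
  omega

@[fun_prop]
theorem PT.drop [Item γ] [Inhabited γ] {l : α → List γ} {f : α → ℕ} (hl : PT l) (hf : PT f) :
    PT (fun x => (l x).drop (f x)) := by
  obtain ⟨p, hp, -⟩ := hl.exists_bound
  refine (PT.iterate_nat (step := List.tail) PT.id.tail hl hf p
    (fun x j hj => ?_)).congr fun x => iterate_tail _ _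
  rw [iterate_tail]
  exact (length_enc_drop_le _ _).trans (hp x)

@[fun_prop]
theorem PT.string_getD {l : α → List Bool} {f : α → ℕ} (hl : PT l) (hf : PT f) :
    PT (fun x => (l x).getD (f x) false) :=
  (hl.string_drop hf).string_headD.congr fun _ => (getD_eq_headD_drop _ _ _).symm

@[fun_prop]
theorem PT.getD [Item γ] [Inhabited γ] {l : α → List γ} {f : α → ℕ} (hl : PT l) (hf : PT f)
    (d : γ) : PT (fun x => (l x).getD (f x) d) :=
  ((hl.drop hf).headD d).congr fun _ => (getD_eq_headD_drop _ _ _).symm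

end


/-! ### Reading and writing circuits -/

/-- This internal code differs from `Circuit.encode`, which the search problems use. It makes the
fields accessible as projections; `PT.decode` and `PT.encode` translate between the two. -/
instance : Code Circuit := ⟨fun C => enc (C.inputs, C.gates, C.outputs)⟩

/-- Read a natural number from the front of a string. -/
def readNat : List Bool → ℕ × List Bool
  | [] => (0, [])
  | false :: l => (0, l)
  | true :: l => ((readNat l).1 + 1, (readNat l).2)

theorem readNat_encodeNat (n : ℕ) (l : List Bool) :
    readNat (Circuit.encodeNat n ++ l) = (n, l) := by
  induction n with
  | zero => rfl
  | succ n ih =>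
    simp only [Circuit.encodeNat, List.replicate_succ, List.cons_append] at ih ⊢
    simp only [readNat, ih]

theorem readNat_le (l : List Bool) : (readNat l).1 + (readNat l).2.length ≤ l.length := by
  induction l with
  | nil => simp [readNat]
  | cons b l ih => cases b <;> simp [readNat]; omega

/-- Read a pair of natural numbers from the front of a string. -/
def readPair (l : List Bool) : (ℕ × ℕ) × List Bool :=
  (((readNat l).1, (readNat (readNat l).2).1), (readNat (readNat l).2).2)

theorem readPair_encodeNat (g : ℕ × ℕ) (l : List Bool) :
    readPair (Circuit.encodeNat g.1 ++ Circuit.encodeNat g.2 ++ l) = (g, l) := by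
  simp [readPair, List.append_assoc, readNat_encodeNat]

/-- Read a given number of items, each of them with `R`, from the front of a string. -/
def readMany {γ : Type} (R : List Bool → γ × List Bool) (k : ℕ) (l : List Bool) :
    List γ × List Bool :=
  (fun y : List γ × List Bool => (y.1 ++ [(R y.2).1], (R y.2).2))^[k] ([], l)

theorem readMany_flatMap {γ : Type} {R : List Bool → γ × List Bool} {e : γ → List Bool}
    (h : ∀ a l, R (e a ++ l) = (a, l)) (as : List γ) (l : List Bool) :
    readMany R as.length (as.flatMap e ++ l) = (as, l) := by
  suffices H : ∀ (as acc : List γ), (fun y : List γ × List Bool =>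
      (y.1 ++ [(R y.2).1], (R y.2).2))^[as.length] (acc, as.flatMap e ++ l) = (acc ++ as, l) by
    exact H as []
  intro as
  induction as with
  | nil => simp
  | cons a as ih =>
    intro acc
    rw [List.length_cons, Function.iterate_succ_apply, List.flatMap_cons, List.append_assoc, h, ih]
    simp

/-- The bound `3 * l.length + 1` fits a pair of numbers with sum at most `l.length`, whose code has
length `2 * a + 1 + b`. As the rest of the string never grows, the bound holds for each item read.
-/
theorem readMany_bound {γ : Type} [Code γ] [Item γ] {R : List Bool → γ × List Bool}
    (hR : ∀ l, (enc (R l).1).length ≤ 3 * l.length + 1 ∧ (R l).2.length ≤ l.length)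
    (k : ℕ) (l : List Bool) :
    (enc (readMany R k l).1).length ≤ k * (6 * l.length + 3) ∧
      (readMany R k l).2.length ≤ l.length := by
  induction k with
  | zero => simp [readMany]
  | succ k ih =>
    have hs : readMany R (k + 1) l = ((readMany R k l).1 ++ [(R (readMany R k l).2).1],
        (R (readMany R k l).2).2) := by
      simp only [readMany, Function.iterate_succ_apply']
    have h := hR (readMany R k l).2
    rw [hs, Nat.add_mul, Nat.one_mul]
    simp only [length_enc_append, length_enc_cons, length_enc_nil]
    omega

/-- The circuit that a string encodes. -/
def decode (x : List Bool) : Circuit :=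
  let a := readNat x
  let b := readNat a.2
  let c := readMany readPair b.1 b.2
  let d := readNat c.2
  let e := readMany readNat d.1 d.2
  ⟨a.1, c.1, e.1⟩

theorem decode_encode (C : Circuit) : decode C.encode = C := by
  have h := readMany_flatMap readNat_encodeNat C.outputs []
  have h' := fun l => readMany_flatMap
    (e := fun g : ℕ × ℕ => Circuit.encodeNat g.1 ++ Circuit.encodeNat g.2) readPair_encodeNat
    C.gates l
  rw [List.append_nil] at h
  simp only [decode, Circuit.encode, List.append_assoc, readNat_encodeNat, h', h]

theorem encode_injective {C D : Circuit} (h : C.encode = D.encode) : C = D := by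
  rw [← decode_encode C, h, decode_encode]

section
variable {α β γ : Type} [Code α] [Code β] [Code γ]

@[fun_prop]
theorem PT.inputs {f : α → Circuit} (hf : PT f) : PT (fun x => (f x).inputs) :=
  PT.fst.comp (hf.recode (g := fun x => ((f x).inputs, (f x).gates, (f x).outputs)) (fun x => x)
    (fun _ => rfl) (fun _ => rfl))

@[fun_prop]
theorem PT.gates {f : α → Circuit} (hf : PT f) : PT (fun x => (f x).gates) :=
  PT.fst.comp (PT.snd.comp (hf.recode
    (g := fun x => ((f x).inputs, (f x).gates, (f x).outputs)) (fun x => x)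
    (fun _ => rfl) (fun _ => rfl)))

@[fun_prop]
theorem PT.outputs {f : α → Circuit} (hf : PT f) : PT (fun x => (f x).outputs) :=
  PT.snd.comp (PT.snd.comp (hf.recode
    (g := fun x => ((f x).inputs, (f x).gates, (f x).outputs)) (fun x => x)
    (fun _ => rfl) (fun _ => rfl)))

@[fun_prop]
theorem PT.circuit_mk {f : α → ℕ} {g : α → List (ℕ × ℕ)} {h : α → List ℕ} (hf : PT f) (hg : PT g)
    (hh : PT h) : PT (fun x => Circuit.mk (f x) (g x) (h x)) :=
  (hf.pair (hg.pair hh)).recode (fun x => x) (fun _ => rfl) (fun _ => rfl)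

@[fun_prop]
theorem PT.readNat {f : α → List Bool} (hf : PT f) : PT (fun x => readNat (f x)) := by
  -- The iteration strips leading bits `true` and becomes stationary at the delimiter `false` or at
  -- the end of the string; the final `tail` removes the delimiter.
  have hs : ∀ (l : List Bool) (j a : ℕ), l.length ≤ j →
      (((fun y : ℕ × List Bool => if y.2.headD false = true then (y.1 + 1, y.2.tail)
        else y)^[j] (a, l)).1, ((fun y : ℕ × List Bool => if y.2.headD false = true
        then (y.1 + 1, y.2.tail) else y)^[j] (a, l)).2.tail) =
        (a + (RamseyPWPP.readNat l).1, (RamseyPWPP.readNat l).2) := by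
    intro l
    induction l with
    | nil => intro j a _; rw [Function.iterate_fixed (by simp)]; rfl
    | cons b l ih =>
      intro j a hj
      cases b with
      | false => rw [Function.iterate_fixed (by simp)]; rfl
      | true =>
        obtain ⟨j, rfl⟩ : ∃ i, j = i + 1 := ⟨j - 1, by simp at hj; omega⟩
        rw [Function.iterate_succ_apply]
        have := ih j (a + 1) (by simpa using hj)
        simp only [List.headD_cons, if_true, List.tail_cons, this, RamseyPWPP.readNat]
        simp only [Prod.mk.injEq, and_true]
        omega
  have hb : ∀ (l : List Bool) (j : ℕ),
      ((fun y : ℕ × List Bool => if y.2.headD false = true then (y.1 + 1, y.2.tail)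
        else y)^[j] (0, l)).1 + ((fun y : ℕ × List Bool => if y.2.headD false = true
        then (y.1 + 1, y.2.tail) else y)^[j] (0, l)).2.length ≤ l.length := by
    intro l j
    induction j with
    | zero => simp
    | succ j ih =>
      rw [Function.iterate_succ_apply']
      generalize (fun y : ℕ × List Bool => if y.2.headD false = true then (y.1 + 1, y.2.tail)
        else y)^[j] (0, l) = z at ih ⊢
      obtain ⟨a, _ | ⟨_ | _, t⟩⟩ := z <;> simp at ih ⊢ <;> omega
  obtain ⟨p, hp, -⟩ := hf.exists_bound
  have h := PT.iterate (step := fun y : ℕ × List Bool => if y.2.headD false = true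
    then (y.1 + 1, y.2.tail) else y) (by fun_prop) (init := fun x => (0, f x)) (by fun_prop) hf
    (2 * p + 1) (fun x j _ => by
      have h₁ := hb (f x) j
      have h₂ := hp x
      simp only [length_enc_prod, length_enc_nat, enc_string, Polynomial.eval_add,
        Polynomial.eval_mul, Polynomial.eval_ofNat, Polynomial.eval_one] at h₁ h₂ ⊢
      omega)
  refine (PT.pair (PT.fst.comp h) (PT.string_tail (PT.snd.comp h))).congr fun x => ?_
  rw [hs _ _ _ le_rfl, Nat.zero_add]

@[fun_prop]
theorem PT.readPair {f : α → List Bool} (hf : PT f) : PT (fun x => readPair (f x)) := by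
  unfold RamseyPWPP.readPair
  fun_prop

theorem PT.readMany [Item γ] {R : List Bool → γ × List Bool} (hR : PT R)
    (hR' : ∀ l, (enc (R l).1).length ≤ 3 * l.length + 1 ∧ (R l).2.length ≤ l.length)
    {k : α → ℕ} {f : α → List Bool} (hk : PT k) (hf : PT f) :
    PT (fun x => readMany R (k x) (f x)) := by
  obtain ⟨p, hp, -⟩ := hk.exists_bound
  obtain ⟨q, hq, -⟩ := hf.exists_bound
  have hs : PT (fun y : List γ × List Bool => (y.1 ++ [(R y.2).1], (R y.2).2)) := by fun_prop
  refine PT.iterate_nat hs (init := fun x => ([], f x)) (by fun_prop) hk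
    (2 * (p * (6 * q + 3)) + 1 + q) (fun x j hj => ?_)
  have h₁ := readMany_bound hR' j (f x)
  have h₂ := hp x
  have h₃ := hq x
  rw [length_enc_nat] at h₂
  rw [enc_string] at h₃
  have h₄ := Nat.mul_le_mul (hj.trans h₂) (show 6 * (f x).length + 3 ≤
    6 * q.eval (enc x).length + 3 by omega)
  simp only [RamseyPWPP.readMany] at h₁
  simp only [length_enc_prod, enc_string, Polynomial.eval_add,
    Polynomial.eval_mul, Polynomial.eval_ofNat, Polynomial.eval_one]
  omega

@[fun_prop]
theorem PT.decode {f : α → List Bool} (hf : PT f) : PT (fun x => decode (f x)) := by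
  have h₁ : ∀ {k : α → ℕ} {f : α → List Bool}, PT k → PT f →
      PT (fun x => RamseyPWPP.readMany RamseyPWPP.readNat (k x) (f x)) := fun hk hf =>
    PT.readMany PT.id.readNat (fun l => by
      have := readNat_le l
      simp only [length_enc_nat]
      omega) hk hf
  have h₂ : ∀ {k : α → ℕ} {f : α → List Bool}, PT k → PT f →
      PT (fun x => RamseyPWPP.readMany RamseyPWPP.readPair (k x) (f x)) := fun hk hf =>
    PT.readMany PT.id.readPair (fun l => by
      have := readNat_le l
      have := readNat_le (RamseyPWPP.readNat l).2
      simp only [length_enc_prod, length_enc_nat, RamseyPWPP.readPair]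
      omega) hk hf
  have hc := h₂ hf.readNat.snd'.readNat.fst' hf.readNat.snd'.readNat.snd'
  exact PT.circuit_mk hf.readNat.fst' hc.fst' (h₁ hc.snd'.readNat.fst' hc.snd'.readNat.snd').fst'

@[fun_prop]
theorem PT.encodeNat {f : α → ℕ} (hf : PT f) : PT (fun x => Circuit.encodeNat (f x)) :=
  hf.to_enc.string_append (PT.const [false])

@[fun_prop]
theorem PT.encode {f : α → Circuit} (hf : PT f) : PT (fun x => (f x).encode) := by
  have h₁ := PT.flatMap_string hf.gates
    (F := fun _ g => Circuit.encodeNat g.1 ++ Circuit.encodeNat g.2) (by fun_prop)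
  have h₂ := PT.flatMap_string hf.outputs (F := fun _ => Circuit.encodeNat) (by fun_prop)
  unfold Circuit.encode
  fun_prop

theorem length_foldl_concat {σ τ : Type} (f : List τ → σ → τ) (l : List σ) (s : List τ) :
    (l.foldl (fun s a => s ++ [f s a]) s).length = s.length + l.length := by
  induction l generalizing s with
  | nil => rfl
  | cons a l ih => rw [List.foldl_cons, ih]; simp; omega

@[fun_prop]
theorem PT.wires {f : α → Circuit} {w : α → List Bool} (hf : PT f) (hw : PT w) :
    PT (fun x => (f x).wires (w x)) := by
  obtain ⟨p, hp, -⟩ := hf.gates.exists_bound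
  obtain ⟨q, hq, -⟩ := hw.exists_bound
  refine PT.foldl (F := fun _ w g => w ++ [!(w.getD g.1 false && w.getD g.2 false)]) hf.gates hw
    (by fun_prop) (p + q) (fun x j => ?_)
  rw [enc_string, length_foldl_concat (fun (w : List Bool) (g : ℕ × ℕ) => !(w.getD g.1 false && w.getD g.2 false))]
  have h₁ := hp x
  have h₂ := hq x
  have h₃ := length_le_length_enc (f x).gates
  simp at h₁ h₂ ⊢
  omega

@[fun_prop]
theorem PT.eval {f : α → Circuit} {w : α → List Bool} (hf : PT f) (hw : PT w) :
    PT (fun x => (f x).eval (w x)) :=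
  (PT.flatMap_string hf.outputs (F := fun x o => [((f x).wires (w x)).getD o false])
    (by fun_prop)).congr fun x => by simp [Circuit.eval, List.map_eq_flatMap]

end


/-! ### Evaluating lists of gates -/

/-- Extend the list `w` of wire values by the values of the gates `gs`. -/
def runGates (gs : List (ℕ × ℕ)) (w : List Bool) : List Bool :=
  gs.foldl (fun w g => w ++ [!(w.getD g.1 false && w.getD g.2 false)]) w

theorem wires_eq_runGates (C : Circuit) (x : List Bool) : C.wires x = runGates C.gates x := rfl

theorem runGates_append (gs gs' : List (ℕ × ℕ)) (w : List Bool) :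
    runGates (gs ++ gs') w = runGates gs' (runGates gs w) := List.foldl_append

theorem runGates_cons (g : ℕ × ℕ) (gs : List (ℕ × ℕ)) (w : List Bool) :
    runGates (g :: gs) w = runGates gs (w ++ [!(w.getD g.1 false && w.getD g.2 false)]) := rfl

@[simp] theorem length_runGates (gs : List (ℕ × ℕ)) (w : List Bool) :
    (runGates gs w).length = w.length + gs.length :=
  length_foldl_concat (fun (w : List Bool) (g : ℕ × ℕ) =>
    !(w.getD g.1 false && w.getD g.2 false)) gs w

theorem getD_append_left {l : List Bool} (l' : List Bool) {i : ℕ} (h : i < l.length) :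
    (l ++ l').getD i false = l.getD i false := by
  rw [List.getD_append _ _ _ _ h]

theorem getD_append_length (l l' : List Bool) (i : ℕ) :
    (l ++ l').getD (l.length + i) false = l'.getD i false := by
  rw [List.getD_append_right _ _ _ _ (by omega), Nat.add_sub_cancel_left]

theorem getD_runGates (gs : List (ℕ × ℕ)) {w : List Bool} {i : ℕ} (hi : i < w.length) :
    (runGates gs w).getD i false = w.getD i false := by
  induction gs generalizing w with
  | nil => rfl
  | cons g gs ih => rw [runGates_cons, ih (by simp; omega), getD_append_left _ hi]

/-- Gates that read wires below `w.length` only. -/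
theorem runGates_map {σ : Type} (F : σ → ℕ × ℕ) (l : List σ) (w : List Bool)
    (h : ∀ a ∈ l, (F a).1 < w.length ∧ (F a).2 < w.length) :
    runGates (l.map F) w =
      w ++ l.map fun a => !(w.getD (F a).1 false && w.getD (F a).2 false) := by
  suffices H : ∀ v, runGates (l.map F) (w ++ v) =
      w ++ v ++ l.map fun a => !(w.getD (F a).1 false && w.getD (F a).2 false) by
    simpa using H []
  induction l with
  | nil => simp [runGates]
  | cons a l ih =>
    intro v
    have ha := h a (by simp)
    rw [List.map_cons, runGates_cons, getD_append_left _ ha.1, getD_append_left _ ha.2,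
      List.append_assoc, ih fun b hb => h b (by simp [hb])]
    simp

theorem getD_runGates_map_range (F : ℕ → ℕ × ℕ) (k : ℕ) (w : List Bool)
    (h : ∀ i < k, (F i).1 < w.length ∧ (F i).2 < w.length) {i : ℕ} (hi : i < k) :
    (runGates ((List.range k).map F) w).getD (w.length + i) false =
      !(w.getD (F i).1 false && w.getD (F i).2 false) := by
  rw [runGates_map _ _ _ (by simpa using h), getD_append_length]
  simp [List.getD_eq_getElem?_getD, hi]

/-- A copy of a circuit, relocated behind the existing wires `w`, computes on `v` what the original
does. This is how copies of `C` are embedded into a larger circuit. -/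
theorem runGates_shift (gs : List (ℕ × ℕ)) (w v : List Bool) :
    runGates (gs.map fun g => (w.length + g.1, w.length + g.2)) (w ++ v) =
      w ++ runGates gs v := by
  induction gs generalizing v with
  | nil => rfl
  | cons g gs ih =>
    rw [List.map_cons, runGates_cons, getD_append_length, getD_append_length, List.append_assoc, ih,
      runGates_cons]

/-- Every gate reads earlier wires only, where the gates are numbered from `W` on. -/
def GatesBelow : ℕ → List (ℕ × ℕ) → Prop
  | _, [] => True
  | W, g :: gs => (g.1 < W ∧ g.2 < W) ∧ GatesBelow (W + 1) gs

theorem gatesBelow_iff (W : ℕ) (gs : List (ℕ × ℕ)) : GatesBelow W gs ↔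
    ∀ (l : ℕ) (h : l < gs.length), gs[l].1 < W + l ∧ gs[l].2 < W + l := by
  induction gs generalizing W with
  | nil => simp [GatesBelow]
  | cons g gs ih =>
    rw [GatesBelow, ih]
    constructor
    · rintro ⟨h₀, h⟩ (_ | l) hl
      · simpa using h₀
      · have := h l (by simpa using hl)
        simp only [List.getElem_cons_succ]
        omega
    · intro h
      refine ⟨h 0 (by simp), fun l hl => ?_⟩
      have := h (l + 1) (by simpa using hl)
      simp only [List.getElem_cons_succ] at this
      omega

theorem gatesBelow_append (W : ℕ) (gs gs' : List (ℕ × ℕ)) :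
    GatesBelow W (gs ++ gs') ↔ GatesBelow W gs ∧ GatesBelow (W + gs.length) gs' := by
  induction gs generalizing W with
  | nil => simp [GatesBelow]
  | cons g gs ih =>
    rw [List.cons_append, GatesBelow, GatesBelow, ih, List.length_cons,
      Nat.add_assoc, Nat.add_comm 1]
    exact and_assoc.symm

theorem gatesBelow_of_forall {W : ℕ} {gs : List (ℕ × ℕ)} (h : ∀ g ∈ gs, g.1 < W ∧ g.2 < W) :
    GatesBelow W gs := by
  rw [gatesBelow_iff]
  intro l hl
  have := h gs[l] (List.getElem_mem hl)
  omega

theorem GatesBelow.shift {W : ℕ} {gs : List (ℕ × ℕ)} (h : GatesBelow W gs) (B : ℕ) :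
    GatesBelow (B + W) (gs.map fun g => (B + g.1, B + g.2)) := by
  induction gs generalizing W with
  | nil => trivial
  | cons g gs ih =>
    refine ⟨⟨?_, ?_⟩, ?_⟩
    · have := h.1.1; simp; omega
    · have := h.1.2; simp; omega
    · rw [Nat.add_assoc]; exact ih h.2

theorem length_flatMap_range {σ : Type} (F : ℕ → List σ) (L n : ℕ) (h : ∀ j, (F j).length = L) :
    ((List.range n).flatMap F).length = n * L := by
  induction n with
  | zero => simp
  | succ n ih => simp [List.range_succ, ih, h, Nat.succ_mul]

theorem gatesBelow_flatMap_range (W L n : ℕ) (F : ℕ → List (ℕ × ℕ)) (hL : ∀ j, (F j).length = L)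
    (h : ∀ j < n, GatesBelow (W + j * L) (F j)) : GatesBelow W ((List.range n).flatMap F) := by
  induction n with
  | zero => trivial
  | succ n ih =>
    rw [List.range_succ, List.flatMap_append, gatesBelow_append, length_flatMap_range F L n hL]
    exact ⟨ih fun j hj => h j (by omega), by simpa using h n (by omega)⟩

/-! ### Iterated hashing -/

/-- The state of the iterated hash function after reading `j` bits of `x`. -/
def hashState (C : Circuit) (x : List Bool) (j : ℕ) : List Bool :=
  (List.range j).foldl (fun s i => C.eval (s ++ [x.getD i false]))
    (C.outputs.map fun _ => false)

theorem hashState_succ (C : Circuit) (x : List Bool) (j : ℕ) :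
    hashState C x (j + 1) = C.eval (hashState C x j ++ [x.getD j false]) := by
  simp [hashState, List.range_succ]

theorem length_hashState (C : Circuit) (x : List Bool) (j : ℕ) :
    (hashState C x j).length = C.outputs.length := by
  cases j with
  | zero => simp [hashState]
  | succ j => rw [hashState_succ, Circuit.eval, List.length_map]

theorem hashState_congr (C : Circuit) {x y : List Bool} {j : ℕ}
    (h : ∀ i < j, x.getD i false = y.getD i false) : hashState C x j = hashState C y j := by
  induction j with
  | zero => rfl
  | succ j ih =>
    rw [hashState_succ, hashState_succ, ih fun i hi => h i (by omega), h j (by omega)]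

/-- Two distinct strings with the same hash value yield a collision. -/
theorem exists_collision (C : Circuit) {x y : List Bool} {n : ℕ} (hx : x.length = n)
    (hy : y.length = n) (hxy : x ≠ y) (h : hashState C x n = hashState C y n) :
    ∃ j < n, hashState C x j ++ [x.getD j false] ≠ hashState C y j ++ [y.getD j false] ∧
      C.eval (hashState C x j ++ [x.getD j false]) =
        C.eval (hashState C y j ++ [y.getD j false]) := by
  by_contra! hc
  -- Without a collision, equal outputs of `C` force equal inputs. So equality of the states
  -- propagates from step `n` back to step `0`.
  have key : ∀ i ≤ n, hashState C x (n - i) = hashState C y (n - i) := by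
    intro i hi
    induction i with
    | zero => simpa using h
    | succ i ih =>
      have ih := ih (by omega)
      rw [show n - i = (n - (i + 1)) + 1 by omega, hashState_succ, hashState_succ] at ih
      by_contra hne
      refine hc (n - (i + 1)) (by omega) (fun he => hne ?_) ih
      exact (List.append_inj he (by simp [length_hashState])).1
  -- The same argument, applied to the last bit of each input of `C`, gives `x = y`.
  refine hxy (List.ext_getElem (hx.trans hy.symm) fun i hi hi' => ?_)
  have h₁ := key (n - (i + 1)) (by omega)
  rw [show n - (n - (i + 1)) = i + 1 by omega, hashState_succ, hashState_succ] at h₁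
  by_contra hne
  refine hc i (by omega) (fun he => hne ?_) h₁
  have := (List.append_inj he (by simp [length_hashState])).2
  simpa [hi, hi'] using this

/-! ### Circuits for the iterated hash function -/

/-- The gates that apply the circuit `C` to the wires `ins`. -/
def stepGates (C : Circuit) (W : ℕ) (ins : List ℕ) : List (ℕ × ℕ) :=
  -- A copy of `C` expects its inputs on consecutive wires. Negating the wires `ins` twice, in two
  -- rows of gates, copies them to the block that starts at `W + (C.outputs.length + 1)`.
  (ins.map fun i => (i, i)) ++
    ((List.range (C.outputs.length + 1)).map fun i => (W + i, W + i)) ++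
    C.gates.map fun g => (W + (C.outputs.length + 1) + g.1, W + (C.outputs.length + 1) + g.2)

/-- The number of gates in `stepGates`. -/
def stepLength (C : Circuit) : ℕ :=
  (C.outputs.length + 1) + (C.outputs.length + 1) + C.gates.length

theorem length_stepGates (C : Circuit) (W : ℕ) {ins : List ℕ}
    (h : ins.length = C.outputs.length + 1) : (stepGates C W ins).length = stepLength C := by
  simp [stepGates, stepLength, h]
  omega

theorem runGates_stepGates (C : Circuit) (w : List Bool) {ins : List ℕ}
    (h : ins.length = C.outputs.length + 1) (hins : ∀ i ∈ ins, i < w.length) :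
    runGates (stepGates C w.length ins) w =
      w ++ (ins.map fun i => !(w.getD i false)) ++ C.wires (ins.map fun i => w.getD i false) := by
  have hl : (w ++ ins.map fun i => !(w.getD i false)).length =
      w.length + (C.outputs.length + 1) := by simp [h]
  have h₂ : runGates ((List.range (C.outputs.length + 1)).map fun i => (w.length + i, w.length + i))
      (w ++ ins.map fun i => !(w.getD i false)) =
      (w ++ ins.map fun i => !(w.getD i false)) ++ ins.map fun i => w.getD i false := by
    rw [runGates_map _ _ _ (fun i hi => by rw [hl]; simp at hi ⊢; omega)]
    congr 1
    refine List.ext_getElem (by simp [h]) fun i hi hi' => ?_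
    simp only [List.getElem_map, List.getElem_range, getD_append_length]
    rw [List.getD_eq_getElem _ _ (by simpa using hi')]
    simp
  have h₁ : runGates (ins.map fun i => (i, i)) w = w ++ ins.map fun i => !(w.getD i false) := by
    rw [runGates_map _ _ _ fun i hi => ⟨hins i hi, hins i hi⟩]
    simp
  rw [stepGates, runGates_append, runGates_append, h₁, h₂, ← hl, runGates_shift]
  rfl

/-- The wires that carry the state of the iterated hash function after `j` steps. -/
def stateWires (C : Circuit) (W z j : ℕ) : List ℕ :=
  C.outputs.map fun o =>
    -- The initial state is zero, so all its bits sit on the constant wire `z`. Later, the copy of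
    -- `C` made in step `j - 1` begins behind its row of negated inputs.
    if (j == 0) = true then z else W + j.pred * stepLength C + (C.outputs.length + 1) + o

/-- The gates that compute the hash value of the `n` wires from `x` on. -/
def hashGates (C : Circuit) (W z x n : ℕ) : List (ℕ × ℕ) :=
  (List.range n).flatMap fun j =>
    stepGates C (W + j * stepLength C) (stateWires C W z j ++ [x + j])

theorem length_hashGates (C : Circuit) (W z x n : ℕ) :
    (hashGates C W z x n).length = n * stepLength C :=
  length_flatMap_range _ _ _ fun j => length_stepGates _ _ (by simp [stateWires])

theorem hashGates_succ (C : Circuit) (W z x n : ℕ) :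
    hashGates C W z x (n + 1) = hashGates C W z x n ++
      stepGates C (W + n * stepLength C) (stateWires C W z n ++ [x + n]) := by
  simp [hashGates, List.range_succ]

theorem stateWires_lt {C : Circuit} (hC : C.WellFormed) (hi : C.inputs = C.outputs.length + 1)
    {W z : ℕ} (hz : z < W) (j : ℕ) :
    ∀ i ∈ stateWires C W z j, i < W + j * stepLength C := by
  intro i h
  simp only [stateWires, List.mem_map] at h
  obtain ⟨o, ho, rfl⟩ := h
  have := hC.2 o ho
  cases j with
  | zero => simpa using hz
  | succ j =>
    simp only [Nat.add_eq_zero_iff, one_ne_zero, and_false, beq_iff_eq, if_false, Nat.pred_succ]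
    rw [Nat.add_mul, Nat.one_mul]
    nth_rw 3 [stepLength]
    omega

/-- Induction on `n`: the gates of one more step only append wires, so the state wires found so far
keep their values. The string `w.drop x` may be longer than `n`, but only its first `n` bits are
read. -/
theorem runGates_hashGates {C : Circuit} (hC : C.WellFormed)
    (hi : C.inputs = C.outputs.length + 1) (w : List Bool) {z x n : ℕ}
    (hz : z < w.length) (hz' : w.getD z false = false) (hx : x + n ≤ w.length) :
    (stateWires C w.length z n).map
      (fun i => (runGates (hashGates C w.length z x n) w).getD i false) =
      hashState C (w.drop x) n := by
  induction n with
  | zero =>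
    simp only [stateWires, hashState, hashGates, runGates, beq_self_eq_true, if_true]
    simp only [List.range_zero, List.flatMap_nil, List.foldl_nil, List.map_map]
    exact List.map_congr_left fun o _ => hz'
  | succ n ih =>
    have ih := ih (by omega)
    have hl : (runGates (hashGates C w.length z x n) w).length =
        w.length + n * stepLength C := by rw [length_runGates, length_hashGates]
    have hs := stateWires_lt hC hi hz n
    have hv : (runGates (hashGates C w.length z x n) w).getD (x + n) false =
        (w.drop x).getD n false := by
      rw [getD_runGates _ (by omega)]
      simp [List.getD_eq_getElem?_getD]
    rw [hashGates_succ, runGates_append, ← hl, runGates_stepGates _ _ (by simp [stateWires]),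
      hashState_succ, ← ih, ← hv, Circuit.eval]
    · rw [show stateWires C w.length z (n + 1) = C.outputs.map fun o =>
        w.length + n * stepLength C + (C.outputs.length + 1) + o by simp [stateWires], List.map_map]
      refine List.map_congr_left fun o ho => ?_
      have hl' : (runGates (hashGates C w.length z x n) w ++
          (stateWires C w.length z n ++ [x + n]).map fun i =>
            !((runGates (hashGates C w.length z x n) w).getD i false)).length =
          w.length + n * stepLength C + (C.outputs.length + 1) := by
        simp [hl, stateWires, Nat.add_assoc]
      simp only [Function.comp]
      rw [← hl', getD_append_length]
      simp
    · intro i h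
      rw [hl]
      rcases List.mem_append.mp h with h | h
      · exact hs i h
      · simp at h; omega

theorem gatesBelow_hashGates {C : Circuit} (hC : C.WellFormed)
    (hi : C.inputs = C.outputs.length + 1) {W z x n : ℕ}
    (hz : z < W) (hx : x + n ≤ W) : GatesBelow W (hashGates C W z x n) := by
  refine gatesBelow_flatMap_range _ _ _ _ (fun j => length_stepGates _ _ (by simp [stateWires]))
    fun j hj => ?_
  have hs := stateWires_lt hC hi hz j
  rw [stepGates, gatesBelow_append, gatesBelow_append]
  refine ⟨⟨gatesBelow_of_forall fun g hg => ?_, gatesBelow_of_forall fun g hg => ?_⟩, ?_⟩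
  · obtain ⟨i, h, rfl⟩ := List.mem_map.mp hg
    rcases List.mem_append.mp h with h | h
    · exact ⟨hs i h, hs i h⟩
    · have := List.mem_singleton.mp h
      simp only
      omega
  · obtain ⟨i, h, rfl⟩ := List.mem_map.mp hg
    have := List.mem_range.mp h
    simp [stateWires]
    omega
  · have h := ((gatesBelow_iff _ _).mpr hC.1).shift
      (W + j * stepLength C + (C.outputs.length + 1))
    rw [hi] at h
    have e : W + j * stepLength C + (C.outputs.length + 1) + (C.outputs.length + 1) =
      W + j * stepLength C + (((stateWires C W z j ++ [x + j]).map fun i => (i, i)) ++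
        ((List.range (C.outputs.length + 1)).map fun i =>
          (W + j * stepLength C + i, W + j * stepLength C + i))).length := by
      simp [stateWires]; omega
    rwa [← e]


/-! ### The color of an edge: the last position where two strings differ -/

/-- The last `i < s` with `d i = true`, or `0` if there is none. -/
def lastTrue (d : ℕ → Bool) : ℕ → ℕ
  | 0 => 0
  | s + 1 => if d s = true then s else lastTrue d s

/-- Positivity of `k` is needed for the default value `0`. -/
theorem lastTrue_lt (d : ℕ → Bool) {s k : ℕ} (hs : s ≤ k) (hk : 0 < k) : lastTrue d s < k := by
  induction s with
  | zero => exact hk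
  | succ s ih =>
    rw [lastTrue]
    split_ifs
    · omega
    · exact ih (by omega)

theorem apply_lastTrue (d : ℕ → Bool) {s i : ℕ} (hi : i < s) (h : d i = true) :
    d (lastTrue d s) = true := by
  induction s with
  | zero => omega
  | succ s ih =>
    rw [lastTrue]
    split_ifs with hs
    · exact hs
    · have : i ≠ s := by rintro rfl; exact hs h
      exact ih (by omega)

theorem ofDigits_testBit (b c : ℕ) (hc : c < 2 ^ b) :
    Nat.ofDigits 2 (((List.range b).map fun l => c.testBit l).map Bool.toNat) = c := by
  induction b generalizing c with
  | zero => simp at hc ⊢; exact hc.symm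
  | succ b ih =>
    have h := ih (c / 2) (by rw [pow_succ] at hc; omega)
    rw [List.range_succ_eq_map, List.map_cons, List.map_cons, Nat.ofDigits_cons]
    simp only [List.map_map, Function.comp_def, Nat.succ_eq_add_one, Nat.testBit_succ] at h ⊢
    rw [h, Nat.testBit_zero]
    rcases Nat.mod_two_eq_zero_or_one c with hm | hm <;> simp [hm] <;> omega

/-! #### Gates that compare two lists of wires -/

/-- The first four layers compute the exclusive or of the wires `A` and `B` by NAND gates, and
the fifth one its negation. -/
def xorGates (W s : ℕ) (A B : List ℕ) : List (ℕ × ℕ) :=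
  ((List.range s).map fun i => (A.getD i 0, B.getD i 0)) ++
    ((List.range s).map fun i => (A.getD i 0, W + i)) ++
    ((List.range s).map fun i => (B.getD i 0, W + i)) ++
    ((List.range s).map fun i => (W + s + i, W + 2 * s + i)) ++
    (List.range s).map fun i => (W + 3 * s + i, W + 3 * s + i)

@[simp] theorem length_xorGates (W s : ℕ) (A B : List ℕ) :
    (xorGates W s A B).length = 5 * s := by
  simp [xorGates]
  omega

theorem gatesBelow_map_range {W k : ℕ} {F : ℕ → ℕ × ℕ}
    (h : ∀ i < k, (F i).1 < W ∧ (F i).2 < W) : GatesBelow W ((List.range k).map F) :=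
  gatesBelow_of_forall fun g hg => by
    obtain ⟨i, hi, rfl⟩ := List.mem_map.mp hg
    exact h i (List.mem_range.mp hi)

theorem gatesBelow_xorGates {W s : ℕ} {A B : List ℕ} (hA : ∀ i < s, A.getD i 0 < W)
    (hB : ∀ i < s, B.getD i 0 < W) : GatesBelow W (xorGates W s A B) := by
  simp only [xorGates, gatesBelow_append, List.length_append, List.length_map, List.length_range]
  refine ⟨⟨⟨⟨?_, ?_⟩, ?_⟩, ?_⟩, ?_⟩ <;> refine gatesBelow_map_range fun i hi => ?_ <;>
    have := hA i hi <;> have := hB i hi <;> simp only <;> omega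

/-- With `c = NAND(a, b)` one has `a xor b = NAND(NAND(a, c), NAND(b, c))`. The layers occupy
consecutive blocks of `s` wires; the negation is kept because the color selection uses both. -/
theorem runGates_xorGates (w : List Bool) {s : ℕ} {A B : List ℕ}
    (hA : ∀ i < s, A.getD i 0 < w.length) (hB : ∀ i < s, B.getD i 0 < w.length) {i : ℕ}
    (hi : i < s) :
    (runGates (xorGates w.length s A B) w).getD (w.length + 3 * s + i) false =
        xor (w.getD (A.getD i 0) false) (w.getD (B.getD i 0) false) ∧
      (runGates (xorGates w.length s A B) w).getD (w.length + 4 * s + i) false =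
        !xor (w.getD (A.getD i 0) false) (w.getD (B.getD i 0) false) := by
  rw [xorGates, runGates_append, runGates_append, runGates_append, runGates_append]
  obtain ⟨w₁, hw₁⟩ : ∃ w₁, w₁ = runGates ((List.range s).map fun i =>
    (A.getD i 0, B.getD i 0)) w := ⟨_, rfl⟩
  rw [← hw₁]
  have l₁ : w₁.length = w.length + s := by simp [hw₁]
  have o₁ : ∀ j < w.length, w₁.getD j false = w.getD j false := fun j hj => by
    rw [hw₁, getD_runGates _ hj]
  have v₁ : w₁.getD (w.length + i) false =
      !(w.getD (A.getD i 0) false && w.getD (B.getD i 0) false) := by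
    rw [hw₁, getD_runGates_map_range _ _ _ (fun i hi => ⟨hA i hi, hB i hi⟩) hi]
  clear hw₁
  obtain ⟨w₂, hw₂⟩ : ∃ w₂, w₂ = runGates ((List.range s).map fun i =>
    (A.getD i 0, w.length + i)) w₁ := ⟨_, rfl⟩
  rw [← hw₂]
  have l₂ : w₂.length = w.length + 2 * s := by simp [hw₂, l₁]; omega
  have o₂ : ∀ j < w₁.length, w₂.getD j false = w₁.getD j false := fun j hj => by
    rw [hw₂, getD_runGates _ hj]
  have v₂ : w₂.getD (w.length + s + i) false =
      !(w.getD (A.getD i 0) false && w₁.getD (w.length + i) false) := by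
    rw [hw₂, ← l₁, getD_runGates_map_range _ _ _ (fun i hi => ?_) hi, o₁ _ (hA i hi)]
    have := hA i hi
    simp only
    omega
  clear hw₂
  obtain ⟨w₃, hw₃⟩ : ∃ w₃, w₃ = runGates ((List.range s).map fun i =>
    (B.getD i 0, w.length + i)) w₂ := ⟨_, rfl⟩
  rw [← hw₃]
  have l₃ : w₃.length = w.length + 3 * s := by simp [hw₃, l₂]; omega
  have o₃ : ∀ j < w₂.length, w₃.getD j false = w₂.getD j false := fun j hj => by
    rw [hw₃, getD_runGates _ hj]
  have v₃ : w₃.getD (w.length + 2 * s + i) false =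
      !(w.getD (B.getD i 0) false && w₁.getD (w.length + i) false) := by
    rw [hw₃, ← l₂, getD_runGates_map_range _ _ _ (fun i hi => ?_) hi,
      o₂ _ (by have := hB i hi; omega), o₁ _ (hB i hi), o₂ _ (by omega)]
    have := hB i hi
    simp only
    omega
  clear hw₃
  obtain ⟨w₄, hw₄⟩ : ∃ w₄, w₄ = runGates ((List.range s).map fun i =>
    (w.length + s + i, w.length + 2 * s + i)) w₃ := ⟨_, rfl⟩
  rw [← hw₄]
  have l₄ : w₄.length = w.length + 4 * s := by simp [hw₄, l₃]; omega
  have v₄ : w₄.getD (w.length + 3 * s + i) false =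
      xor (w.getD (A.getD i 0) false) (w.getD (B.getD i 0) false) := by
    rw [hw₄, ← l₃, getD_runGates_map_range _ _ _ (fun i hi => by simp only; omega) hi,
      o₃ _ (by omega), v₂, v₃, v₁]
    cases w.getD (A.getD i 0) false <;> cases w.getD (B.getD i 0) false <;> rfl
  clear hw₄
  refine ⟨?_, ?_⟩
  · rw [getD_runGates _ (by omega), v₄]
  · rw [← l₄, getD_runGates_map_range _ _ _ (fun i hi => by simp only; omega) hi, v₄, Bool.and_self]

/-! #### Gates that select a color -/

/-- The wires with the digits of the color after `i` selections. -/
def colorWire (M b z i l : ℕ) : ℕ :=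
  if (i == 0) = true then z else M + i.pred * (3 * b) + 2 * b + l

/-- If the wire `X + i` is on, where `X + s + i` carries its negation, replace the color by `i`. -/
def selectGates (M b z X s i : ℕ) : List (ℕ × ℕ) :=
  -- A multiplexer for each digit: with `d` on wire `X + i`, the three rows are `NAND(d, new)`,
  -- `NAND(¬d, old)` and the NAND of these, which is `(d ∧ new) ∨ (¬d ∧ old)`. The digits of `i` are
  -- constants, taken from the wires `z - 1` (on) and `z` (off).
  ((List.range b).map fun l => (X + i, if i.testBit l = true then z - 1 else z)) ++
    ((List.range b).map fun l => (X + s + i, colorWire M b z i l)) ++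
    (List.range b).map fun l => (M + i * (3 * b) + l, M + i * (3 * b) + b + l)

theorem length_selectGates (M b z X s i : ℕ) :
    (selectGates M b z X s i).length = 3 * b := by
  simp [selectGates]
  omega

/-- The gates that compute the digits of the last index of a wire that is on. -/
def colorGates (M b z X s : ℕ) : List (ℕ × ℕ) :=
  (List.range s).flatMap (selectGates M b z X s)

theorem length_colorGates (M b z X s : ℕ) :
    (colorGates M b z X s).length = s * (3 * b) :=
  length_flatMap_range _ _ _ (length_selectGates _ _ _ _ _)

theorem colorWire_lt {M z : ℕ} (b i l : ℕ) (hz : z < M) (hl : l < b) :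
    colorWire M b z i l < M + i * (3 * b) := by
  cases i with
  | zero => simpa [colorWire] using hz
  | succ i =>
    simp only [colorWire, Nat.add_eq_zero_iff, one_ne_zero, and_false, beq_iff_eq, if_false,
      Nat.pred_succ]
    rw [Nat.add_mul]
    omega

theorem gatesBelow_colorGates {M b z X s : ℕ} (hz : z < M) (hX : X + 2 * s ≤ M) :
    GatesBelow M (colorGates M b z X s) := by
  refine gatesBelow_flatMap_range _ _ _ _ (length_selectGates _ _ _ _ _) fun i hi => ?_
  simp only [selectGates, gatesBelow_append, List.length_append, List.length_map,
    List.length_range]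
  refine ⟨⟨?_, ?_⟩, ?_⟩ <;> refine gatesBelow_map_range fun l hl => ?_ <;>
    have := colorWire_lt b i l hz hl <;> simp only
  · split_ifs <;> omega
  · omega
  · omega

/-- The `n`-th selection implements one step of the recursion of `lastTrue`: later positions
overwrite earlier ones, and the color starts as zero. -/
theorem runGates_colorGates (w : List Bool) {b z X s n : ℕ} (d : ℕ → Bool) (hn : n ≤ s)
    (hz : z < w.length) (hz' : w.getD z false = false) (ho : w.getD (z - 1) false = true)
    (hX : X + 2 * s ≤ w.length) (hd : ∀ i < s, w.getD (X + i) false = d i)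
    (hd' : ∀ i < s, w.getD (X + s + i) false = !d i) {l : ℕ} (hl : l < b) :
    (runGates ((List.range n).flatMap (selectGates w.length b z X s)) w).getD
      (colorWire w.length b z n l) false = (lastTrue d n).testBit l := by
  induction n generalizing l with
  | zero => simpa [colorWire, lastTrue, runGates] using hz'
  | succ n ih =>
    have ih := fun l (hl : l < b) => ih (by omega) (l := l) hl
    have hcw := fun l (hl : l < b) => colorWire_lt (M := w.length) b n l hz hl
    obtain ⟨w', hw'⟩ : ∃ w', w' = runGates ((List.range n).flatMap
      (selectGates w.length b z X s)) w := ⟨_, rfl⟩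
    have l' : w'.length = w.length + n * (3 * b) := by
      rw [hw', length_runGates, length_flatMap_range _ _ _ (length_selectGates _ _ _ _ _)]
    have o' : ∀ j < w.length, w'.getD j false = w.getD j false := fun j hj => by
      rw [hw', getD_runGates _ hj]
    rw [List.range_succ, List.flatMap_append, runGates_append, List.flatMap_singleton]
    rw [← hw'] at ih ⊢
    clear hw'
    rw [selectGates, runGates_append, runGates_append]
    obtain ⟨w₁, hw₁⟩ : ∃ w₁, w₁ = runGates ((List.range b).map fun l =>
      (X + n, if n.testBit l = true then z - 1 else z)) w' := ⟨_, rfl⟩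
    rw [← hw₁]
    have l₁ : w₁.length = w'.length + b := by simp [hw₁]
    have o₁ : ∀ j < w'.length, w₁.getD j false = w'.getD j false := fun j hj => by
      rw [hw₁, getD_runGates _ hj]
    have v₁ : w₁.getD (w'.length + l) false = !(d n && n.testBit l) := by
      rw [hw₁, getD_runGates_map_range _ _ _ (fun i hi => by simp only; split_ifs <;> omega) hl,
        o' _ (by omega), hd n (by omega)]
      simp only
      split_ifs with h
      · rw [o' _ (by omega), ho, h]
      · rw [o' _ hz, hz']; simp [h]
    clear hw₁
    obtain ⟨w₂, hw₂⟩ : ∃ w₂, w₂ = runGates ((List.range b).map fun l =>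
      (X + s + n, colorWire w.length b z n l)) w₁ := ⟨_, rfl⟩
    rw [← hw₂]
    have l₂ : w₂.length = w'.length + 2 * b := by simp [hw₂, l₁]; omega
    have o₂ : ∀ j < w₁.length, w₂.getD j false = w₁.getD j false := fun j hj => by
      rw [hw₂, getD_runGates _ hj]
    have v₂ : w₂.getD (w'.length + b + l) false = !(!d n && (lastTrue d n).testBit l) := by
      rw [hw₂, ← l₁, getD_runGates_map_range _ _ _ (fun i hi => by
          have := hcw i hi
          simp only
          omega) hl, o₁ _ (by omega), o' _ (by omega), hd' n (by omega),
        o₁ _ (by have := hcw l hl; omega), ih l hl]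
    clear hw₂
    have e : colorWire w.length b z (n + 1) l = w₂.length + l := by
      simp [colorWire, l₂, l']
    rw [e, getD_runGates_map_range _ _ _ (fun i hi => by simp only; omega) hl, ← l',
      o₂ _ (by omega), v₁, v₂, lastTrue]
    cases h : d n <;> simp


/-! ### The circuit that colors the edges -/

/-- The circuit that colors the edge between two strings of length `n` by the last position where
their hash values differ. The wires `2 * n + 1` and `2 * n + 2` are constantly on and off. -/
def colorCircuit (C : Circuit) (n : ℕ) : Circuit where
  inputs := 2 * n
  gates :=
    -- Constants from an input bit `x`: `NAND(x, x) = ¬x`, then `NAND(x, ¬x)` is true, and its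
    -- negation is false. This requires `n > 0`.
    [(0, 0), (0, 2 * n), (2 * n + 1, 2 * n + 1)] ++
    hashGates C (2 * n + 3) (2 * n + 2) 0 n ++
    hashGates C (2 * n + 3 + n * stepLength C) (2 * n + 2) n n ++
    xorGates (2 * n + 3 + n * stepLength C + n * stepLength C) C.outputs.length
      (stateWires C (2 * n + 3) (2 * n + 2) n)
      (stateWires C (2 * n + 3 + n * stepLength C) (2 * n + 2) n) ++
    colorGates (2 * n + 3 + n * stepLength C + n * stepLength C + 5 * C.outputs.length)
      C.outputs.length (2 * n + 2)
      (2 * n + 3 + n * stepLength C + n * stepLength C + 3 * C.outputs.length) C.outputs.length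
  -- The color is written with as many digits as there are positions. This is more than necessary,
  -- but avoids logarithms.
  outputs := (List.range C.outputs.length).map
    (colorWire (2 * n + 3 + n * stepLength C + n * stepLength C + 5 * C.outputs.length)
      C.outputs.length (2 * n + 2) C.outputs.length)

theorem getD_stateWires_lt {C : Circuit} (hC : C.WellFormed)
    (hi : C.inputs = C.outputs.length + 1) {W z : ℕ} (hz : z < W) (j : ℕ) :
    ∀ i < C.outputs.length, (stateWires C W z j).getD i 0 < W + j * stepLength C := by
  intro i h
  have h' : i < (stateWires C W z j).length := by simpa [stateWires] using h
  rw [List.getD_eq_getElem _ _ h']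
  exact stateWires_lt hC hi hz j _ (List.getElem_mem h')

theorem wellFormed_colorCircuit {C : Circuit} (hC : C.WellFormed)
    (hi : C.inputs = C.outputs.length + 1) {n : ℕ} (hn : 0 < n) :
    (colorCircuit C n).WellFormed := by
  refine ⟨(gatesBelow_iff _ _).mp ?_, fun o ho => ?_⟩
  · simp only [colorCircuit, gatesBelow_append, List.length_append, length_hashGates,
      length_xorGates, List.length_cons, List.length_nil, ← Nat.add_assoc]
    refine ⟨⟨⟨⟨?_, ?_⟩, ?_⟩, ?_⟩, ?_⟩
    · simp [GatesBelow]; omega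
    · exact gatesBelow_hashGates hC hi (by omega) (by omega)
    · exact gatesBelow_hashGates hC hi (by omega) (by omega)
    · refine gatesBelow_xorGates (fun i h => ?_) (fun i h => ?_)
      · have := getD_stateWires_lt hC hi (show 2 * n + 2 < 2 * n + 3 by omega) n i h
        omega
      · exact getD_stateWires_lt hC hi (by omega) n i h
    · exact gatesBelow_colorGates (by omega) (by omega)
  · simp only [colorCircuit, List.mem_map, List.mem_range] at ho
    obtain ⟨l, hl, rfl⟩ := ho
    have := colorWire_lt (M := 2 * n + 3 + n * stepLength C + n * stepLength C +
      5 * C.outputs.length) (z := 2 * n + 2) C.outputs.length C.outputs.length l (by omega) hl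
    simp only [colorCircuit, List.length_append, length_hashGates, length_xorGates,
      length_colorGates, List.length_cons, List.length_nil]
    omega

/-- Whether the hash values of `u` and `v` differ at the position `i`. -/
def hashDiff (C : Circuit) (n : ℕ) (u v : List Bool) (i : ℕ) : Bool :=
  xor ((hashState C u n).getD i false) ((hashState C v n).getD i false)

theorem getD_map_getD {A : List ℕ} {w h : List Bool} (e : A.map (fun i => w.getD i false) = h)
    {i : ℕ} (hi : i < A.length) : w.getD (A.getD i 0) false = h.getD i false := by
  subst e
  simp [List.getD_eq_getElem?_getD, hi]

theorem runGates_constants {t : List Bool} (ht : 0 < t.length) :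
    runGates [(0, 0), (0, t.length), (t.length + 1, t.length + 1)] t =
      t ++ [!t.getD 0 false, true, false] := by
  have h₁ := getD_append_length t [!t.getD 0 false] 0
  have h₂ := getD_append_length t [!t.getD 0 false, true] 1
  simp only [runGates_cons, Bool.and_self]
  rw [getD_append_left _ ht]
  simp only [Nat.add_zero] at h₁
  rw [h₁]
  have h₃ : (!(t.getD 0 false && [!t.getD 0 false].getD 0 false)) = true := by
    generalize t.getD 0 false = b
    cases b <;> rfl
  rw [h₃]
  simp only [List.append_assoc, List.cons_append, List.nil_append]
  rw [h₂]
  simp [runGates]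

/-- The blocks of gates are run one after the other, with wire values `w₀` (constants), `w₁` and
`w₂` (the two hash values) and `w₃` (their differences). Each block leaves the earlier wires
untouched, so the specifications of the blocks can be chained. -/
theorem edgeColor_colorCircuit {C : Circuit} (hC : C.WellFormed)
    (hi : C.inputs = C.outputs.length + 1) {n : ℕ} (hn : 0 < n) {u v : List Bool}
    (hu : u.length = n) (hv : v.length = n) :
    edgeColor (colorCircuit C n) u v = lastTrue (hashDiff C n u v) C.outputs.length := by
  obtain ⟨w₀, hw₀⟩ : ∃ w, w = runGates [(0, 0), (0, 2 * n), (2 * n + 1, 2 * n + 1)] (u ++ v) :=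
    ⟨_, rfl⟩
  have l₀ : w₀.length = 2 * n + 3 := by simp [hw₀, hu, hv]; omega
  have hl : (u ++ v).length = 2 * n := by simp [hu, hv]; omega
  have e₀ : w₀ = u ++ v ++ [!(u ++ v).getD 0 false, true, false] := by
    rw [hw₀, ← hl]
    exact runGates_constants (by omega)
  have z₀ : w₀.getD (2 * n + 2) false = false := by
    rw [e₀, ← hl, getD_append_length]; rfl
  have t₀ : w₀.getD (2 * n + 1) false = true := by
    rw [e₀, ← hl, getD_append_length]; rfl
  obtain ⟨w₁, hw₁⟩ : ∃ w, w = runGates (hashGates C (2 * n + 3) (2 * n + 2) 0 n) w₀ := ⟨_, rfl⟩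
  have l₁ : w₁.length = 2 * n + 3 + n * stepLength C := by simp [hw₁, l₀, length_hashGates]
  have o₁ : ∀ j < 2 * n + 3, w₁.getD j false = w₀.getD j false := fun j hj => by
    rw [hw₁, getD_runGates _ (by omega)]
  have v₁ : (stateWires C (2 * n + 3) (2 * n + 2) n).map (fun i => w₁.getD i false) =
      hashState C u n := by
    have h := runGates_hashGates hC hi w₀ (z := 2 * n + 2) (x := 0) (n := n) (by omega) z₀
      (by omega)
    rw [l₀, ← hw₁] at h
    rw [h, List.drop_zero]
    refine hashState_congr C fun i hi => ?_
    rw [e₀, List.append_assoc, getD_append_left _ (by omega)]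
  obtain ⟨w₂, hw₂⟩ : ∃ w, w = runGates (hashGates C (2 * n + 3 + n * stepLength C)
    (2 * n + 2) n n) w₁ := ⟨_, rfl⟩
  have l₂ : w₂.length = 2 * n + 3 + n * stepLength C + n * stepLength C := by
    simp [hw₂, l₁, length_hashGates]
  have o₂ : ∀ j < 2 * n + 3 + n * stepLength C, w₂.getD j false = w₁.getD j false :=
    fun j hj => by rw [hw₂, getD_runGates _ (by omega)]
  have v₂ : (stateWires C (2 * n + 3 + n * stepLength C) (2 * n + 2) n).map
      (fun i => w₂.getD i false) = hashState C v n := by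
    have h := runGates_hashGates hC hi w₁ (z := 2 * n + 2) (x := n) (n := n) (by omega)
      (by rw [o₁ _ (by omega), z₀]) (by omega)
    rw [l₁, ← hw₂] at h
    rw [h]
    refine hashState_congr C fun i hi => ?_
    have h₁ : (w₁.drop n).getD i false = w₁.getD (n + i) false := by
      simp [List.getD_eq_getElem?_getD]
    rw [h₁, o₁ _ (by omega), e₀, getD_append_left _ (by omega), ← hu, getD_append_length]
  have hA : ∀ i < C.outputs.length, (stateWires C (2 * n + 3) (2 * n + 2) n).getD i 0 <
      2 * n + 3 + n * stepLength C := getD_stateWires_lt hC hi (by omega) n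
  have hB : ∀ i < C.outputs.length, (stateWires C (2 * n + 3 + n * stepLength C)
      (2 * n + 2) n).getD i 0 < w₂.length := by
    rw [l₂]; exact getD_stateWires_lt hC hi (by omega) n
  obtain ⟨w₃, hw₃⟩ : ∃ w, w = runGates (xorGates (2 * n + 3 + n * stepLength C + n * stepLength C)
    C.outputs.length (stateWires C (2 * n + 3) (2 * n + 2) n)
    (stateWires C (2 * n + 3 + n * stepLength C) (2 * n + 2) n)) w₂ := ⟨_, rfl⟩
  have l₃ : w₃.length = 2 * n + 3 + n * stepLength C + n * stepLength C +
      5 * C.outputs.length := by simp [hw₃, l₂]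
  have o₃ : ∀ j < 2 * n + 3, w₃.getD j false = w₀.getD j false :=
    fun j hj => by rw [hw₃, getD_runGates _ (by omega), o₂ _ (by omega), o₁ _ hj]
  have v₃ : ∀ i < C.outputs.length,
      w₃.getD (w₂.length + 3 * C.outputs.length + i) false = hashDiff C n u v i ∧
      w₃.getD (w₂.length + 4 * C.outputs.length + i) false = !hashDiff C n u v i := by
    intro i hi
    have h := runGates_xorGates w₂ (s := C.outputs.length)
      (A := stateWires C (2 * n + 3) (2 * n + 2) n)
      (B := stateWires C (2 * n + 3 + n * stepLength C) (2 * n + 2) n) (fun i hi => by have := hA i hi; omega) hB hi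
    rw [l₂, ← hw₃, ← l₂] at h
    rw [h.1, h.2, o₂ _ (hA i hi), getD_map_getD v₁ (by simpa [stateWires] using hi),
      getD_map_getD v₂ (by simpa [stateWires] using hi)]
    exact ⟨rfl, rfl⟩
  have hw : (colorCircuit C n).wires (u ++ v) = runGates (colorGates w₃.length C.outputs.length
      (2 * n + 2) (w₂.length + 3 * C.outputs.length) C.outputs.length) w₃ := by
    rw [wires_eq_runGates, colorCircuit]
    simp only [runGates_append]
    rw [← hw₀, ← hw₁, ← hw₂, ← hw₃, l₃, l₂]
  rw [edgeColor, Circuit.eval, hw, ← ofDigits_testBit C.outputs.length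
    (lastTrue (hashDiff C n u v) C.outputs.length)]
  · congr 2
    rw [colorCircuit]
    simp only [List.map_map]
    refine List.map_congr_left fun l hl => ?_
    rw [List.mem_range] at hl
    have h := runGates_colorGates w₃ (b := C.outputs.length) (z := 2 * n + 2)
      (X := w₂.length + 3 * C.outputs.length) (s := C.outputs.length) (n := C.outputs.length)
      (hashDiff C n u v) le_rfl (by omega)
      (by rw [o₃ _ (by omega), z₀]) (by rw [o₃ _ (by omega), ← t₀]; rfl) (by omega)
      (fun i hi => (v₃ i hi).1)
      (fun i hi => by rw [← (v₃ i hi).2]; congr 1; omega) hl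
    rw [← h, Function.comp, colorGates, l₃]
  · exact lastTrue_lt _ Nat.lt_two_pow_self.le (by positivity)

theorem hashDiff_comm (C : Circuit) (n : ℕ) (u v : List Bool) :
    hashDiff C n u v = hashDiff C n v u := by
  funext i
  exact Bool.xor_comm _ _

theorem colorsEdges_colorCircuit {C : Circuit} (hC : C.WellFormed)
    (hi : C.inputs = C.outputs.length + 1) {n k : ℕ} (hn : 0 < n) (hk : C.inputs ≤ k) :
    ColorsEdges (colorCircuit C n) n k := by
  refine ⟨wellFormed_colorCircuit hC hi hn, rfl, fun u v hu hv _ => ?_⟩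
  rw [edgeColor_colorCircuit hC hi hn hu hv, edgeColor_colorCircuit hC hi hn hv hu,
    hashDiff_comm C n v u]
  -- Since `C.inputs = C.outputs.length + 1 ≤ k`, there is room for all positions and `k` is
  -- positive, even if `C` has no outputs.
  exact ⟨rfl, lastTrue_lt _ (by omega) (by omega)⟩

/-- Distinct hash values differ at some position, so the color is a genuine position of difference
and not the default `0`. -/
theorem hashDiff_edgeColor {C : Circuit} (hC : C.WellFormed)
    (hi : C.inputs = C.outputs.length + 1) {n : ℕ} (hn : 0 < n) {u v : List Bool}
    (hu : u.length = n) (hv : v.length = n) (h : hashState C u n ≠ hashState C v n) :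
    hashDiff C n u v (edgeColor (colorCircuit C n) u v) = true := by
  rw [edgeColor_colorCircuit hC hi hn hu hv]
  by_contra hd
  refine h (List.ext_getElem (by simp [length_hashState]) fun i h₁ h₂ => ?_)
  by_contra hne
  refine hd (apply_lastTrue _ (i := i) (by simpa [length_hashState] using h₁) ?_)
  simpa [hashDiff, h₁, h₂] using hne

/-- Among three vertices of a monochromatic clique two have the same hash value. -/
theorem exists_hashState_eq {C : Circuit} (hC : C.WellFormed)
    (hi : C.inputs = C.outputs.length + 1) {n : ℕ} (hn : 0 < n) {u v w : List Bool}
    (hu : u.length = n) (hv : v.length = n) (hw : w.length = n)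
    {c : ℕ} (huv : edgeColor (colorCircuit C n) u v = c)
    (huw : edgeColor (colorCircuit C n) u w = c) (hvw : edgeColor (colorCircuit C n) v w = c) :
    hashState C u n = hashState C v n ∨ hashState C u n = hashState C w n ∨
      hashState C v n = hashState C w n := by
  by_contra! h
  have h₁ := hashDiff_edgeColor hC hi hn hu hv h.1
  have h₂ := hashDiff_edgeColor hC hi hn hu hw h.2.1
  have h₃ := hashDiff_edgeColor hC hi hn hv hw h.2.2
  rw [huv] at h₁
  rw [huw] at h₂
  rw [hvw] at h₃
  simp only [hashDiff] at h₁ h₂ h₃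
  -- Three bits cannot be pairwise different.
  revert h₁ h₂ h₃
  cases (hashState C u n).getD c false <;> cases (hashState C v n).getD c false <;>
    cases (hashState C w n).getD c false <;> simp


/-! ### The coloring circuit is computable in polynomial time -/

section
variable {α : Type} [Code α]

@[fun_prop]
theorem PT.sub_one {f : α → ℕ} (hf : PT f) : PT (fun x => f x - 1) := hf.pred

@[fun_prop]
theorem PT.stepLength {C : α → Circuit} (hC : PT C) : PT (fun x => stepLength (C x)) := by
  unfold RamseyPWPP.stepLength
  fun_prop

@[fun_prop]
theorem PT.stepGates {C : α → Circuit} {W : α → ℕ} {ins : α → List ℕ} (hC : PT C) (hW : PT W)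
    (hins : PT ins) : PT (fun x => stepGates (C x) (W x) (ins x)) :=
  ((PT.map hins (F := fun _ i => (i, i)) (by fun_prop)).append
    (PT.map (l := fun x => List.range ((C x).outputs.length + 1)) (by fun_prop)
      (F := fun x i => (W x + i, W x + i)) (by fun_prop))).append
    (PT.map hC.gates (F := fun x g => (W x + ((C x).outputs.length + 1) + g.1,
      W x + ((C x).outputs.length + 1) + g.2)) (by fun_prop))

@[fun_prop]
theorem PT.stateWires {C : α → Circuit} {W z j : α → ℕ} (hC : PT C) (hW : PT W) (hz : PT z)
    (hj : PT j) : PT (fun x => stateWires (C x) (W x) (z x) (j x)) :=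
  PT.map hC.outputs (F := fun x o => if (j x == 0) = true then z x else
    W x + (j x).pred * RamseyPWPP.stepLength (C x) + ((C x).outputs.length + 1) + o) (by fun_prop)

@[fun_prop]
theorem PT.hashGates {C : α → Circuit} {W z s n : α → ℕ} (hC : PT C) (hW : PT W) (hz : PT z)
    (hs : PT s) (hn : PT n) : PT (fun x => hashGates (C x) (W x) (z x) (s x) (n x)) :=
  PT.flatMap hn.range (F := fun x j =>
    RamseyPWPP.stepGates (C x) (W x + j * RamseyPWPP.stepLength (C x))
      (RamseyPWPP.stateWires (C x) (W x) (z x) j ++ [s x + j])) (by fun_prop)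

@[fun_prop]
theorem PT.xorGates {W s : α → ℕ} {A B : α → List ℕ} (hW : PT W) (hs : PT s) (hA : PT A)
    (hB : PT B) : PT (fun x => xorGates (W x) (s x) (A x) (B x)) := by
  have h₁ := PT.map hs.range (F := fun x i => ((A x).getD i 0, (B x).getD i 0)) (by fun_prop)
  have h₂ := PT.map hs.range (F := fun x i => ((A x).getD i 0, W x + i)) (by fun_prop)
  have h₃ := PT.map hs.range (F := fun x i => ((B x).getD i 0, W x + i)) (by fun_prop)
  have h₄ := PT.map hs.range (F := fun x i => (W x + s x + i, W x + 2 * s x + i)) (by fun_prop)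
  have h₅ := PT.map hs.range (F := fun x i => (W x + 3 * s x + i, W x + 3 * s x + i))
    (by fun_prop)
  exact (((h₁.append h₂).append h₃).append h₄).append h₅

@[fun_prop]
theorem PT.colorWire {M b z i l : α → ℕ} (hM : PT M) (hb : PT b) (hz : PT z) (hi : PT i)
    (hl : PT l) : PT (fun x => colorWire (M x) (b x) (z x) (i x) (l x)) := by
  unfold RamseyPWPP.colorWire
  fun_prop

@[fun_prop]
theorem PT.selectGates {M b z X s i : α → ℕ} (hM : PT M) (hb : PT b) (hz : PT z) (hX : PT X)
    (hs : PT s) (hi : PT i) : PT (fun x => selectGates (M x) (b x) (z x) (X x) (s x) (i x)) := by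
  have h₁ := PT.map hb.range
    (F := fun x l => (X x + i x, if (i x).testBit l = true then z x - 1 else z x)) (by fun_prop)
  have h₂ := PT.map hb.range
    (F := fun x l => (X x + s x + i x, RamseyPWPP.colorWire (M x) (b x) (z x) (i x) l))
    (by fun_prop)
  have h₃ := PT.map hb.range
    (F := fun x l => (M x + i x * (3 * b x) + l, M x + i x * (3 * b x) + b x + l)) (by fun_prop)
  exact (h₁.append h₂).append h₃

@[fun_prop]
theorem PT.colorGates {M b z X s : α → ℕ} (hM : PT M) (hb : PT b) (hz : PT z) (hX : PT X)
    (hs : PT s) : PT (fun x => colorGates (M x) (b x) (z x) (X x) (s x)) :=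
  PT.flatMap hs.range (F := fun x => RamseyPWPP.selectGates (M x) (b x) (z x) (X x) (s x))
    (by fun_prop)

@[fun_prop]
theorem PT.colorCircuit {C : α → Circuit} {n : α → ℕ} (hC : PT C) (hn : PT n) :
    PT (fun x => colorCircuit (C x) (n x)) := by
  unfold RamseyPWPP.colorCircuit
  refine PT.circuit_mk (by fun_prop) (by fun_prop) (PT.map hC.outputs.length.range
    (F := fun x => RamseyPWPP.colorWire (2 * n x + 3 + n x * RamseyPWPP.stepLength (C x) +
      n x * RamseyPWPP.stepLength (C x) + 5 * (C x).outputs.length)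
      (C x).outputs.length (2 * n x + 2) (C x).outputs.length) (by fun_prop))

end

/-! ### Finding a collision in a monochromatic clique -/

/-- The first `n` bits of `l`, padded with zeros. -/
def takePad (n : ℕ) (l : List Bool) : List Bool :=
  (List.range n).flatMap fun i => [l.getD i false]

theorem takePad_append {n : ℕ} {l : List Bool} (l' : List Bool) (h : l.length = n) :
    takePad n (l ++ l') = l := by
  subst h
  rw [takePad, ← List.map_eq_flatMap]
  refine List.ext_getElem (by simp) fun i h₁ h₂ => ?_
  rw [List.getElem_map, List.getElem_range, getD_append_left _ h₂, List.getD_eq_getElem _ _ h₂]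

/-- Whether two strings differ in the first `n` bits. -/
def differ (n : ℕ) (p q : List Bool) : Bool :=
  !((List.range n).flatMap fun i =>
    if (p.getD i false == q.getD i false) = true then [] else [true]).isEmpty

theorem differ_iff {n : ℕ} {p q : List Bool} (hp : p.length = n) (hq : q.length = n) :
    differ n p q = true ↔ p ≠ q := by
  rw [differ, Bool.not_eq_true', ← Bool.not_eq_true, List.isEmpty_iff, not_iff_not]
  simp only [List.flatMap_eq_nil_iff, List.mem_range, beq_iff_eq, ite_eq_left_iff,
    List.cons_ne_nil, imp_false, not_not]
  constructor
  · intro h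
    refine List.ext_getElem (hp.trans hq.symm) fun i h₁ h₂ => ?_
    simpa [h₁, h₂] using h i (by omega)
  · rintro rfl _ _
    rfl

/-- The input of the circuit in the `j`-th step of the iterated hash function. -/
def stepInput (C : Circuit) (u : List Bool) (j : ℕ) : List Bool :=
  hashState C u j ++ [u.getD j false]

/-- The collisions that occur in the same step when `u` and `v` are hashed. -/
def stepCollisions (C : Circuit) (n : ℕ) (u v : List Bool) : List Bool :=
  (List.range n).flatMap fun j =>
    if (differ C.inputs (stepInput C u j) (stepInput C v j) &&
      !differ C.outputs.length (C.eval (stepInput C u j)) (C.eval (stepInput C v j))) = true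
    then stepInput C u j ++ stepInput C v j else []

/-- A collision obtained from a list of three strings of length `n`, two of which have the same
hash value. -/
def findCollision (C : Circuit) (n : ℕ) (y : List Bool) : List Bool :=
  takePad (C.inputs + C.inputs)
    (stepCollisions C n (takePad n y) (takePad n (y.drop n)) ++
      (stepCollisions C n (takePad n y) (takePad n (y.drop (2 * n))) ++
        stepCollisions C n (takePad n (y.drop n)) (takePad n (y.drop (2 * n)))))

/-- The codes of the collisions of `C`. -/
def CodesCollision (C : Circuit) (y : List Bool) : Prop :=
  ∃ u v : List Bool, y = u ++ v ∧ u.length = C.inputs ∧ v.length = C.inputs ∧ u ≠ v ∧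
    C.eval u = C.eval v

/-- The string is empty or begins with the code of a collision. -/
def StartsWithCollision (C : Circuit) (y : List Bool) : Prop :=
  y = [] ∨ ∃ a b, y = a ++ b ∧ CodesCollision C a

/-- Closure under concatenation replaces a search: all candidates are concatenated, and whatever
comes first is a collision. -/
theorem StartsWithCollision.append {C : Circuit} {y y' : List Bool}
    (h : StartsWithCollision C y) (h' : StartsWithCollision C y') :
    StartsWithCollision C (y ++ y') := by
  obtain rfl | ⟨a, b, rfl, h⟩ := h
  · exact h'
  · exact Or.inr ⟨a, b ++ y', by simp, h⟩

theorem StartsWithCollision.takePad {C : Circuit} {y : List Bool}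
    (h : StartsWithCollision C y) (hy : y ≠ []) :
    CodesCollision C (takePad (C.inputs + C.inputs) y) := by
  obtain rfl | ⟨a, b, rfl, h⟩ := h
  · exact absurd rfl hy
  · have hl : a.length = C.inputs + C.inputs := by
      obtain ⟨u, v, rfl, hu, hv, -⟩ := h
      simp [hu, hv]
    rwa [takePad_append _ hl]

theorem StartsWithCollision.flatMap {σ : Type} {C : Circuit} (l : List σ) {F : σ → List Bool}
    (h : ∀ a ∈ l, StartsWithCollision C (F a)) : StartsWithCollision C (l.flatMap F) := by
  induction l with
  | nil => exact Or.inl rfl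
  | cons a l ih =>
    rw [List.flatMap_cons]
    exact (h a (by simp)).append (ih fun b hb => h b (by simp [hb]))

theorem length_stepInput {C : Circuit} (hi : C.inputs = C.outputs.length + 1) (u : List Bool)
    (j : ℕ) : (stepInput C u j).length = C.inputs := by
  simp [stepInput, length_hashState, hi]

/-- Soundness of the search: a block is emitted only after the test that it codes a collision. -/
theorem startsWithCollision_stepCollisions {C : Circuit} (hi : C.inputs = C.outputs.length + 1)
    (n : ℕ) (u v : List Bool) : StartsWithCollision C (stepCollisions C n u v) := by
  refine .flatMap _ fun j _ => ?_
  split_ifs with h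
  · rw [Bool.and_eq_true, differ_iff (length_stepInput hi u j) (length_stepInput hi v j),
      Bool.not_eq_true', ← Bool.not_eq_true, differ_iff (by simp [Circuit.eval])
      (by simp [Circuit.eval]), not_not] at h
    exact Or.inr ⟨_, [], (List.append_nil _).symm, _, _, rfl, length_stepInput hi u j,
      length_stepInput hi v j, h⟩
  · exact Or.inl rfl

/-- Completeness of the search: the step provided by `exists_collision` passes the test. -/
theorem stepCollisions_ne_nil {C : Circuit} (hi : C.inputs = C.outputs.length + 1)
    {n : ℕ} {u v : List Bool} (hu : u.length = n) (hv : v.length = n) (huv : u ≠ v)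
    (h : hashState C u n = hashState C v n) : stepCollisions C n u v ≠ [] := by
  obtain ⟨j, hj, h₁, h₂⟩ := exists_collision C hu hv huv h
  rw [stepCollisions, Ne, List.flatMap_eq_nil_iff, not_forall]
  refine ⟨j, fun h₃ => ?_⟩
  have h₃ := h₃ (List.mem_range.mpr hj)
  rw [if_pos] at h₃
  · have := congrArg List.length h₃
    simp [stepInput] at this
  · rw [Bool.and_eq_true, differ_iff (length_stepInput hi u j) (length_stepInput hi v j),
      Bool.not_eq_true', ← Bool.not_eq_true, differ_iff (by simp [Circuit.eval])
      (by simp [Circuit.eval]), not_not]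
    exact ⟨h₁, h₂⟩

/-- Only the first three vertices matter. As all vertices have length `n`, they are read off the
concatenation at the offsets `0`, `n` and `2 * n`; by `exists_hashState_eq` at least one of the
three pairs contributes a collision. -/
theorem codesCollision_findCollision {C : Circuit} (hC : C.WellFormed)
    (hi : C.inputs = C.outputs.length + 1) {n t : ℕ} (hn : 0 < n) (ht : 3 ≤ t)
    {a : List (List Bool)} (ha : IsMonochromaticClique (colorCircuit C n) n t a) :
    CodesCollision C (findCollision C n a.flatten) := by
  obtain ⟨hl, hd, hlen, c, hc⟩ := ha
  obtain ⟨u, v, w, r, rfl⟩ : ∃ u v w r, a = u :: v :: w :: r := by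
    rcases a with _ | ⟨u, _ | ⟨v, _ | ⟨w, r⟩⟩⟩
    · simp at hl; omega
    · simp at hl; omega
    · simp at hl; omega
    · exact ⟨u, v, w, r, rfl⟩
  have hu := hlen u (by simp)
  have hv := hlen v (by simp)
  have hw := hlen w (by simp)
  simp only [List.nodup_cons, List.mem_cons, not_or] at hd
  have huv : u ≠ v := hd.1.1
  have huw : u ≠ w := hd.1.2.1
  have hvw : v ≠ w := hd.2.1.1
  have e : (u :: v :: w :: r).flatten = u ++ (v ++ (w ++ r.flatten)) := by simp
  have e₀ : takePad n (u :: v :: w :: r).flatten = u := by rw [e, takePad_append _ hu]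
  have e₁ : takePad n ((u :: v :: w :: r).flatten.drop n) = v := by
    rw [e, ← hu, List.drop_left, hu, takePad_append _ hv]
  have e₂ : takePad n ((u :: v :: w :: r).flatten.drop (2 * n)) = w := by
    have h : 2 * n = (u ++ v).length := by simp [hu, hv]; omega
    rw [e, ← List.append_assoc, h, List.drop_left, takePad_append _ hw]
  rw [findCollision, e₀, e₁, e₂]
  have hs := startsWithCollision_stepCollisions hi n
  refine ((hs u v).append ((hs u w).append (hs v w))).takePad fun h => ?_
  rw [List.append_eq_nil_iff, List.append_eq_nil_iff] at h
  rcases exists_hashState_eq hC hi hn hu hv hw (hc u (by simp) v (by simp) huv)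
    (hc u (by simp) w (by simp) huw) (hc v (by simp) w (by simp) hvw) with h' | h' | h'
  · exact stepCollisions_ne_nil hi hu hv huv h' h.1
  · exact stepCollisions_ne_nil hi hu hw huw h' h.2.1
  · exact stepCollisions_ne_nil hi hv hw hvw h' h.2.2

section
variable {α : Type} [Code α]

@[fun_prop]
theorem PT.takePad {n : α → ℕ} {l : α → List Bool} (hn : PT n) (hl : PT l) :
    PT (fun x => takePad (n x) (l x)) :=
  PT.flatMap_string hn.range (F := fun x i => [(l x).getD i false]) (by fun_prop)

@[fun_prop]
theorem PT.differ {n : α → ℕ} {p q : α → List Bool} (hn : PT n) (hp : PT p) (hq : PT q) :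
    PT (fun x => differ (n x) (p x) (q x)) :=
  (PT.flatMap_string hn.range (F := fun x i =>
    if ((p x).getD i false == (q x).getD i false) = true then [] else [true])
    (by fun_prop)).string_isEmpty.not

@[fun_prop]
theorem PT.hashState {C : α → Circuit} {u : α → List Bool} {j : α → ℕ} (hC : PT C) (hu : PT u)
    (hj : PT j) : PT (fun x => hashState (C x) (u x) (j x)) := by
  obtain ⟨p, hp, -⟩ := hC.outputs.exists_bound
  have h₀ : PT (fun x => (C x).outputs.map fun _ => false) :=
    (PT.flatMap_string hC.outputs (F := fun _ _ => [false]) (by fun_prop)).congr fun x => by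
      simp [List.map_eq_flatMap]
  refine PT.foldl hj.range h₀ (F := fun x s i => (C x).eval (s ++ [(u x).getD i false]))
    (by fun_prop) p fun x i => ?_
  -- The fold stopped early is again a hash state, and every hash state has `C.outputs.length` bits;
  -- this bounds the intermediate values.
  have := length_hashState (C x) (u x) (min i (j x))
  rw [RamseyPWPP.hashState] at this
  rw [List.take_range, enc_string, this]
  exact (length_le_length_enc _).trans (hp x)

@[fun_prop]
theorem PT.stepInput {C : α → Circuit} {u : α → List Bool} {j : α → ℕ} (hC : PT C) (hu : PT u)
    (hj : PT j) : PT (fun x => stepInput (C x) (u x) (j x)) := by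
  unfold RamseyPWPP.stepInput
  fun_prop

@[fun_prop]
theorem PT.stepCollisions {C : α → Circuit} {n : α → ℕ} {u v : α → List Bool} (hC : PT C)
    (hn : PT n) (hu : PT u) (hv : PT v) :
    PT (fun x => stepCollisions (C x) (n x) (u x) (v x)) :=
  PT.flatMap_string hn.range (F := fun x j =>
    if (RamseyPWPP.differ (C x).inputs (RamseyPWPP.stepInput (C x) (u x) j)
        (RamseyPWPP.stepInput (C x) (v x) j) &&
      !RamseyPWPP.differ (C x).outputs.length ((C x).eval (RamseyPWPP.stepInput (C x) (u x) j))
        ((C x).eval (RamseyPWPP.stepInput (C x) (v x) j))) = true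
    then RamseyPWPP.stepInput (C x) (u x) j ++ RamseyPWPP.stepInput (C x) (v x) j else [])
    (by fun_prop)

@[fun_prop]
theorem PT.findCollision {C : α → Circuit} {n : α → ℕ} {y : α → List Bool} (hC : PT C)
    (hn : PT n) (hy : PT y) : PT (fun x => findCollision (C x) (n x) (y x)) := by
  unfold RamseyPWPP.findCollision
  fun_prop

end

/-! ### The reduction -/

/-- Instances are mapped forward by `f' ∘ f`, and solutions are pulled back first by `g'` at the
instance `f x`, then by `g`. Polynomial time comes from the passage through `PT`. -/
theorem Reduces.trans {P Q R : SearchProblem} (h : Reduces P Q) (h' : Reduces Q R) :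
    Reduces P R := by
  obtain ⟨f, g, hf, hg, h⟩ := h
  obtain ⟨f', g', hf', hg', h'⟩ := h'
  have pf := PT.of_polyTime₁ hf
  have pf' := PT.of_polyTime₁ hf'
  have pg := PT.of_polyTime₂ hg
  have pg' := PT.of_polyTime₂ hg'
  refine ⟨fun x => f' (f x), fun x y => g x (g' (f x) y), (pf'.comp pf).polyTime₁,
    PT.polyTime₂ ?_, fun x hx => ?_⟩
  · exact pg.comp (f := fun x : List Bool × List Bool => (x.1, g' (f x.1) x.2))
      (PT.fst.pair (pg'.comp (f := fun x : List Bool × List Bool => (f x.1, x.2))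
        ((pf.comp PT.fst).pair PT.snd)))
  · obtain ⟨h₁, h₂⟩ := h x hx
    obtain ⟨h₃, h₄⟩ := h' _ h₁
    exact ⟨h₃, fun y hy => h₂ _ (h₄ y hy)⟩

/-- The vertices get length `n = (m + c) ^ e`, where `m` is the number of inputs; for fixed `c` and
`e` this is computable in unary in polynomial time. The bound `m + 2 ≤ k n` ensures both `2 ≤ k n`
and enough colors. -/
theorem reduces_colorRamsey (k t : ℕ → ℕ) (c e : ℕ) (hc : 0 < c)
    (hk : ∀ m, m + 2 ≤ k ((m + c) ^ e)) (ht : ∀ m, 3 ≤ t ((m + c) ^ e)) :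
    Reduces weakPigeon (colorRamsey k t) := by
  refine ⟨fun x => (colorCircuit (decode x) (((decode x).inputs + c) ^ e)).encode,
    fun x y => findCollision (decode x) (((decode x).inputs + c) ^ e) y,
    PT.polyTime₁ (by fun_prop), PT.polyTime₂ (by fun_prop), ?_⟩
  rintro _ ⟨C, rfl, hC, hi⟩
  simp only [decode_encode]
  have hn : 0 < (C.inputs + c) ^ e := by positivity
  have hk := hk C.inputs
  refine ⟨⟨_, _, rfl, by omega, colorsEdges_colorCircuit hC hi hn (by omega)⟩, ?_⟩
  rintro y ⟨D, n, hD, hDn, a, rfl, ha⟩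
  -- A solution refers to some circuit with the given code and some `n`; the code determines the
  -- circuit, and its number `2 * n` of inputs determines `n`.
  obtain rfl := encode_injective hD
  obtain rfl : (C.inputs + c) ^ e = n := by simp only [colorCircuit] at hDn; omega
  obtain ⟨u, v, h⟩ := codesCollision_findCollision hC hi hn (ht C.inputs) ha
  exact ⟨C, rfl, u, v, h⟩

/-! ### The choice of the parameters. -/

theorem three_le_cliqueSize {δ : ℝ} (hδ₀ : 0 < δ) (hδ : δ < 1 / 2) {n : ℕ} (hn : 6561 ≤ n)
    (hk : 2 ≤ ⌊(n : ℝ) ^ δ⌋₊) :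
    3 ≤ ⌊(n : ℝ) / ((⌊(n : ℝ) ^ δ⌋₊ : ℝ) * Real.logb 2 (⌊(n : ℝ) ^ δ⌋₊ : ℝ))⌋₊ := by
  have hN : (6561 : ℝ) ≤ n := by exact_mod_cast hn
  have hN0 : (0 : ℝ) < n := by linarith
  have hK : (2 : ℝ) ≤ (⌊(n : ℝ) ^ δ⌋₊ : ℝ) := by exact_mod_cast hk
  have hK' : (⌊(n : ℝ) ^ δ⌋₊ : ℝ) ≤ (n : ℝ) ^ (1 / 2 : ℝ) :=
    (Nat.floor_le (by positivity)).trans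
      (Real.rpow_le_rpow_of_exponent_le (by linarith) hδ.le)
  generalize (⌊(n : ℝ) ^ δ⌋₊ : ℝ) = K at hK hK'
  have hK0 : 0 < K := by linarith
  have hlog2 := Real.log_two_gt_d9
  have hlogK : 0 < Real.log K := Real.log_pos (by linarith)
  have h₁ : Real.log K ≤ K ^ (1 / 2 : ℝ) / (1 / 2) := Real.log_le_rpow_div hK0.le (by norm_num)
  -- From `log K ≤ 2 * K ^ (1/2)` and `log 2 > 2 / 3`.
  have h₂ : Real.logb 2 K ≤ 3 * K ^ (1 / 2 : ℝ) := by
    rw [Real.logb, div_le_iff₀ (by linarith)]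
    have : 0 < K ^ (1 / 2 : ℝ) := by positivity
    nlinarith
  have h₃ : K ^ (1 / 2 : ℝ) ≤ (n : ℝ) ^ (1 / 4 : ℝ) := by
    calc K ^ (1 / 2 : ℝ) ≤ ((n : ℝ) ^ (1 / 2 : ℝ)) ^ (1 / 2 : ℝ) :=
          Real.rpow_le_rpow hK0.le hK' (by norm_num)
      _ = (n : ℝ) ^ (1 / 4 : ℝ) := by rw [← Real.rpow_mul hN0.le]; norm_num
  -- Here `6561 = 9 ^ 4`. One factor `3` of `9` pays for the constant in the bound on the logarithm,
  -- the other for the clique size.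
  have h₄ : (9 : ℝ) ≤ (n : ℝ) ^ (1 / 4 : ℝ) := by
    calc (9 : ℝ) = (6561 : ℝ) ^ (1 / 4 : ℝ) := by
          rw [show (6561 : ℝ) = 9 ^ (4 : ℝ) by norm_num, ← Real.rpow_mul (by norm_num)]
          norm_num
      _ ≤ _ := Real.rpow_le_rpow (by norm_num) hN (by norm_num)
  have h₅ : (n : ℝ) = (n : ℝ) ^ (1 / 2 : ℝ) * ((n : ℝ) ^ (1 / 4 : ℝ) * (n : ℝ) ^ (1 / 4 : ℝ)) := by
    rw [← Real.rpow_add hN0, ← Real.rpow_add hN0]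
    norm_num
  have hlb : 0 < Real.logb 2 K := Real.logb_pos (by norm_num) (by linarith)
  refine Nat.le_floor ?_
  rw [le_div_iff₀ (by positivity), h₅]
  have h₆ : K * Real.logb 2 K ≤
      (n : ℝ) ^ (1 / 2 : ℝ) * (3 * (n : ℝ) ^ (1 / 4 : ℝ)) :=
    mul_le_mul hK' (h₂.trans (by linarith)) hlb.le (by positivity)
  have h₇ : 0 < (n : ℝ) ^ (1 / 2 : ℝ) * (n : ℝ) ^ (1 / 4 : ℝ) := by positivity
  push_cast
  nlinarith

/-- For `e ≥ 1 / δ` and `a ≥ 1` one has `(a ^ e) ^ δ = a ^ (e * δ) ≥ a`. -/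
theorem exists_exponent {δ : ℝ} (hδ₀ : 0 < δ) :
    ∃ e : ℕ, 0 < e ∧ ∀ a : ℕ, 0 < a → a ≤ ⌊((a ^ e : ℕ) : ℝ) ^ δ⌋₊ := by
  obtain ⟨e, he⟩ := exists_nat_ge (1 / δ)
  have he' : 1 ≤ (e : ℝ) * δ := by rwa [div_le_iff₀ hδ₀] at he
  refine ⟨e, Nat.pos_of_ne_zero ?_, fun a ha => Nat.le_floor ?_⟩
  · rintro rfl
    norm_num at he'
  · have ha' : (1 : ℝ) ≤ a := by exact_mod_cast ha
    rw [Nat.cast_pow, ← Real.rpow_natCast, ← Real.rpow_mul (by linarith)]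
    calc (a : ℝ) = (a : ℝ) ^ (1 : ℝ) := (Real.rpow_one _).symm
      _ ≤ _ := Real.rpow_le_rpow_of_exponent_le ha' he'

end RamseyPWPP

theorem mainTheorem6 (δ : ℝ) (hδ₀ : 0 < δ) (hδ : δ < 1 / 2) :
    RamseyPWPP.PWPPHard (RamseyPWPP.standardRamsey fun n => ⌊(n : ℝ) ^ δ⌋₊) := by
  intro P hP
  obtain ⟨e, he, h⟩ := RamseyPWPP.exists_exponent hδ₀
  -- The shift by `6561` guarantees at once `n ≥ 6561`, as the clique size requires, and more than
  -- `m + 2` colors.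
  have hk : ∀ m : ℕ, m + 6561 ≤ ⌊(((m + 6561) ^ e : ℕ) : ℝ) ^ δ⌋₊ := fun m => h _ (by omega)
  refine hP.2.trans (RamseyPWPP.reduces_colorRamsey _ _ 6561 e (by omega) (fun m => ?_) fun m => ?_)
  · have := hk m
    omega
  · have := hk m
    exact RamseyPWPP.three_le_cliqueSize hδ₀ hδ
      ((by omega : 6561 ≤ m + 6561).trans (Nat.le_self_pow he.ne' _)) (by omega)
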